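/- **Setting.** Let $\mathbb Z$-arithmetic ($\mathcal Z$) be the set of all closed first-order formulas over the signature $\Sigma_{\mathbb Z}$ (a constant for each integer, binary $+$, unary $-$, $\le$) that are true in the standard model. Let $\Sigma$ be a signature disjoint from $\Sigma_{\mathbb Z}$ whose symbols are coded by natural numbers, and let $T$ be a $\Sigma$-theory (a set of closed formulas). $T$ is *decidable* if there is an algorithm that decides, for finite conjunctions of $\Sigma$-literals, whether they are satisfiable together with $T$. $T$ is *stably infinite* if every $T$-satisfiable quantifier-free $\Sigma$-formula is satisfied in some model of $T$ with an infinite domain. $F\models_{T} G$ means that $F\wedge\neg G$ is not satisfiable together with $T$. Fix a countably infinite set of variables. An *instance* of ILP Modulo $T$ is a triple $(\mathcal C,I,O)$: a finite set $\mathcal C$ of integer linear constraints ($\sum_i c_iv_i\bowtie r$ with $\bowtie\in\{<,\le,=,>,\ge\}$ and integer data), a finite set $I$ of interface atoms, and an integer linear expression $O$, to be minimized. An interface atom is an atomic $\Sigma$-formula $t$, or an annotated one $t^v$, which stands for $t\Leftrightarrow v>0$. An integer assignment $A$ is a *$T$-model* of $C\wedge D\wedge I$ if $A$ satisfies the constraints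 in $C$ and $D$, and $\{v=A(v)\}_v\cup I$ is satisfiable together with $\mathcal Z\cup T$. Write $\mathrm{obj}(A)$ for the value of $O$ under $A$, $\mathrm{obj}(\mathrm{None})=+\infty$, $\mathrm{obj}(A^{-\infty})=-\infty$. A *simple equality* is a constraint $v=c$ or $v-w=c$. A *subproblem* $\langle C,D\rangle$ is a finite set $C$ of constraints with a finite set $D$ of simple equalities. A *state* $P\parallel A$ is a finite set $P$ of subproblems with $A$ being $\mathrm{None}$, an assignment, or an assignment annotated with $-\infty$. Let $lb$ be any function such that $lb(\langle C,D\rangle)\le \mathrm{obj}(A)$ for every assignment $A$ satisfying $C\wedge D$. The transitions of $\mathrm{BC}(T)$ act on one subproblem $\langle C,D\rangle$ of $P\uplus\{\langle C,D\rangle\}\parallel A$; below, added constraints $c$ and simple equalities $d$ are not yet in $C$, $D$: - Branch: replace it by $\langle C_1,D\rangle,\dots,\langle C_n,D\rangle$, where $n>1$, the $C_i$ are distinct, and $D\models_{\mathcal Z}(C\Leftrightarrow\bigvee_i C_i)$. - Learn: replace it by $\langle C\cup\{c\},D\rangle$ if $C\wedge D\models_{\mathcal Z}c$. Forget: the reverse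 step, under the same condition. Propagate: replace it by $\langle C,D\cup\{d\}\rangle$ if $C\wedge D\models_{\mathcal Z}d$. - Drop: remove it if no integer assignment satisfies $C\wedge D$. Prune: remove it if $A\ne\mathrm{None}$ and $lb(\langle C,D\rangle)\ge\mathrm{obj}(A)$. - Retire: remove it and replace $A$ by a $T$-model $A'$ of $C\wedge D\wedge I$ of least objective value among these $T$-models, if $\mathrm{obj}(A')<\mathrm{obj}(A)$. - Unbounded: go to $\emptyset\parallel A'^{-\infty}$ if $A'$ is a $T$-model of $C\wedge D\wedge I$, $\mathrm{obj}(A')\le\mathrm{obj}(A)$, and the $T$-models of $C\wedge D\wedge I$ have arbitrarily low objective values. - $T$-Learn: replace it by $\langle C\cup\{c\},D\rangle$ if for some $(\Sigma\cup\Sigma_{\mathbb Z})$-formula $F$ both $C\wedge D\models_{\mathcal Z}F$ and $F\wedge I\models_T c$. **Theorem 4 (Completeness).** Let $T$ be a decidable, stably infinite theory. Then $\mathrm{BC}(T)$ is a complete optimization procedure for ILP Modulo $T$: there is an algorithm (a partial recursive function on codes) that, for every instance $(\mathcal C,I,O)$, halts and outputs a finite $\mathrm{BC}(T)$ run (valid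 for every lower-bounding function $lb$ for $O$) from the starting state $\{\langle\mathcal C,\emptyset\rangle\}\parallel\mathrm{None}$ to a final state $\emptyset\parallel A$, whose report is correct: if $A=\mathrm{None}$, then $\mathcal C\wedge I$ has no $T$-model; if $A$ is an assignment without annotation, then it is a $T$-model of $\mathcal C\wedge I$ of least objective value; and if $A$ is annotated with $-\infty$, then it is a $T$-model of $\mathcal C\wedge I$ and the objective values of the $T$-models of $\mathcal C\wedge I$ are unbounded below. In particular, every instance has such a finite run. -/

import Mathlib

open scoped FirstOrder

namespace IMT

section Arithmetic

/-! ### Integer linear constraints -/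

/-- An integer assignment, on the fixed set `ℕ` of variables. -/
abbrev Assignment := ℕ → ℤ

/-- An integer linear expression `c₁ v₁ + ... + cₙ vₙ`, as the list of the pairs `(cᵢ, vᵢ)`. -/
abbrev LinExpr := List (ℤ × ℕ)

/-- The value of a linear expression under an assignment. -/
def LinExpr.eval (e : LinExpr) (A : Assignment) : ℤ := (e.map fun p => p.1 * A p.2).sum

/-- The five relations `<`, `≤`, `=`, `>`, `≥`. -/
inductive Rel where
  | lt | le | eq | gt | ge
  deriving DecidableEq

/-- The meaning of the five relations over the integers. -/
def Rel.Holds : Rel → ℤ → ℤ → Prop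
  | .lt, x, y => x < y
  | .le, x, y => x ≤ y
  | .eq, x, y => x = y
  | .gt, x, y => x > y
  | .ge, x, y => x ≥ y

/-- An integer linear constraint `e ⋈ r`, as the triple `(e, ⋈, r)`. -/
abbrev Constraint := LinExpr × Rel × ℤ

/-- The assignment `A` satisfies the constraint. -/
def Constraint.Sat (c : Constraint) (A : Assignment) : Prop :=
  c.2.1.Holds (LinExpr.eval c.1 A) c.2.2

/-- A simple equality: `v = c` or `v - w = c`. -/
inductive SimpleEq where
  | single (v : ℕ) (c : ℤ)
  | diff (v w : ℕ) (c : ℤ)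
  deriving DecidableEq

/-- A simple equality is a special case of an integer linear constraint. -/
def SimpleEq.toConstraint : SimpleEq → Constraint
  | .single v c => ([(1, v)], .eq, c)
  | .diff v w c => ([(1, v), (-1, w)], .eq, c)

end Arithmetic

section Logic

/-! ### First-order satisfiability modulo a theory -/

variable {K : FirstOrder.Language.{0, 0}}

/-- The set `Γ` of formulas (with free variables in `ℕ`) is satisfiable together with `T`.
The languages below are countable, so models in `Type` are enough. -/
def Satisfiable (T : K.Theory) (Γ : Set (K.Formula ℕ)) : Prop :=
  ∃ (M : Type) (_ : K.Structure M) (v : ℕ → M), M ⊨ T ∧ ∀ φ ∈ Γ, φ.Realize v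

/-- `Γ` entails `φ` modulo `T`: `Γ` and the negation of `φ` are not `T`-satisfiable. -/
def Entails (T : K.Theory) (Γ : Set (K.Formula ℕ)) (φ : K.Formula ℕ) : Prop :=
  ¬ Satisfiable T (Γ ∪ {φ.not})

/-- Every `T`-satisfiable quantifier-free formula has a `T`-model with an infinite domain. -/
def StablyInfinite (T : K.Theory) : Prop :=
  ∀ φ : K.Formula ℕ, φ.IsQF → Satisfiable T {φ} →
    ∃ (M : Type) (_ : K.Structure M) (v : ℕ → M), Infinite M ∧ M ⊨ T ∧ φ.Realize v

end Logic

section LIA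

/-! ### Linear integer arithmetic as a first-order theory -/

/-- Function symbols: a constant for every integer, binary `+`, unary `-`. -/
inductive IntFunc : ℕ → Type where
  | const (z : ℤ) : IntFunc 0
  | add : IntFunc 2
  | neg : IntFunc 1

/-- Predicate symbols: `≤`. -/
inductive IntRel : ℕ → Type where
  | le : IntRel 2

/-- The signature of linear integer arithmetic. -/
def intLang : FirstOrder.Language.{0, 0} := ⟨IntFunc, IntRel⟩

/-- The standard model. -/
instance intStructure : intLang.Structure ℤ where
  funMap := fun {n} (f : IntFunc n) => match n, f with
    | _, .const z => fun _ => z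
    | _, .add => fun x => x 0 + x 1
    | _, .neg => fun x => - x 0
  RelMap := fun {n} (r : IntRel n) => match n, r with
    | _, .le => fun x => x 0 ≤ x 1

/-- The closed formulas that are true in the standard model. -/
def intTheory : intLang.Theory := intLang.completeTheory ℤ

/-- The constant symbol of `z`, as a symbol of the signature. -/
def constSym (z : ℤ) : intLang.Functions 0 := IntFunc.const z

/-- The symbol `+`. -/
def addSym : intLang.Functions 2 := IntFunc.add

/-- The symbol `-`. -/
def negSym : intLang.Functions 1 := IntFunc.neg

/-- The symbol `≤`. -/
def leSym : intLang.Relations 2 := IntRel.le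

/-- The constant `z`, as a term. -/
def numeral (z : ℤ) : intLang.Term ℕ := .func (constSym z) ![]

/-- The term `s + t`. -/
def addTerm (s t : intLang.Term ℕ) : intLang.Term ℕ := .func addSym ![s, t]

/-- The term `- t`. -/
def negTerm (t : intLang.Term ℕ) : intLang.Term ℕ := .func negSym ![t]

/-- The formula `s ≤ t`. -/
def leFormula (s t : intLang.Term ℕ) : intLang.Formula ℕ := leSym.formula ![s, t]

/-- Multiplication by a natural number, as repeated addition. -/
def natMulTerm : ℕ → intLang.Term ℕ → intLang.Term ℕ
  | 0, _ => numeral 0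
  | n + 1, t => addTerm (natMulTerm n t) t

/-- Multiplication by an integer constant, as repeated addition. -/
def intMulTerm : ℤ → intLang.Term ℕ → intLang.Term ℕ
  | .ofNat n, t => natMulTerm n t
  | .negSucc n, t => negTerm (natMulTerm (n + 1) t)

/-- A linear expression as a term. -/
def LinExpr.toTerm : LinExpr → intLang.Term ℕ
  | [] => numeral 0
  | (c, v) :: e => addTerm (intMulTerm c (.var v)) (LinExpr.toTerm e)

/-- A relation between two terms as a formula. -/
def Rel.toFormula : Rel → intLang.Term ℕ → intLang.Term ℕ → intLang.Formula ℕ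
  | .lt, s, t => (leFormula t s).not
  | .le, s, t => leFormula s t
  | .eq, s, t => s.equal t
  | .gt, s, t => (leFormula s t).not
  | .ge, s, t => leFormula t s

end LIA

section Combined

/-! ### The combination of linear integer arithmetic with a theory `T`

The disjoint union of the signatures is `intLang.sum L`. -/

variable (L : FirstOrder.Language.{0, 0})

/-- Linear integer arithmetic over the combined signature. -/
def zTheory : (intLang.sum L).Theory := (FirstOrder.Language.LHom.sumInl).onTheory intTheory

variable {L}

/-- The theory `T` over the combined signature. -/
def tTheory (T : L.Theory) : (intLang.sum L).Theory := (FirstOrder.Language.LHom.sumInr).onTheory T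

variable (L)

/-- A constraint as a formula over the combined signature. -/
def Constraint.toFormula (c : Constraint) : (intLang.sum L).Formula ℕ :=
  (FirstOrder.Language.LHom.sumInl).onFormula (c.2.1.toFormula (LinExpr.toTerm c.1) (numeral c.2.2))

/-- The formulas of a finite set of constraints. -/
def cFormulas (C : Finset Constraint) : Set ((intLang.sum L).Formula ℕ) :=
  {φ | ∃ c ∈ C, φ = Constraint.toFormula L c}

/-- The formulas of a finite set of simple equalities. -/
def dFormulas (D : Finset SimpleEq) : Set ((intLang.sum L).Formula ℕ) :=
  {φ | ∃ d ∈ D, φ = Constraint.toFormula L d.toConstraint}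

/-- The conjunction of a finite set of constraints. -/
noncomputable def cConj (C : Finset Constraint) : (intLang.sum L).Formula ℕ :=
  FirstOrder.Language.Formula.iInf fun c : C => Constraint.toFormula L c.1

/-- An assignment `A` as the set of the formulas `v = A(v)`. -/
def aFormulas (A : Assignment) : Set ((intLang.sum L).Formula ℕ) :=
  {φ | ∃ v : ℕ, φ = Constraint.toFormula L (SimpleEq.single v (A v)).toConstraint}

/-- An atomic formula over the signature of `T`: an equality of terms or the application of a
predicate symbol. -/
inductive Atom where
  | eq (s t : L.Term ℕ)
  | rel {n : ℕ} (R : L.Relations n) (ts : Fin n → L.Term ℕ)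

/-- An interface atom: an atomic formula, possibly annotated with a variable. -/
structure InterfaceAtom where
  atom : Atom L
  ann : Option ℕ

/-- An instance of ILP modulo `T`. The two finite sets are presented by lists of their elements,
since an instance is also the input of an algorithm. -/
structure Instance where
  constraints : List Constraint
  interface : List (InterfaceAtom L)
  objective : LinExpr

variable {L}

/-- An atom as a first-order formula over the signature of `T`. -/
def Atom.toFormula : Atom L → L.Formula ℕ
  | .eq s t => s.equal t
  | .rel R ts => R.formula ts

/-- An interface atom as a formula: the atom itself, or, with the annotation `v`, the equivalence
of the atom and `v > 0`. -/
def InterfaceAtom.toFormula (a : InterfaceAtom L) : (intLang.sum L).Formula ℕ :=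
  match a.ann with
  | none => (FirstOrder.Language.LHom.sumInr).onFormula a.atom.toFormula
  | some v => ((FirstOrder.Language.LHom.sumInr).onFormula a.atom.toFormula).iff
      (Constraint.toFormula L ([(1, v)], .gt, 0))

/-- The formulas of the interface atoms of an instance. -/
def Instance.iFormulas (Q : Instance L) : Set ((intLang.sum L).Formula ℕ) :=
  {φ | ∃ a ∈ Q.interface, φ = a.toFormula}

end Combined

section System

/-! ### Branch and cut modulo `T` -/

/-- A subproblem: a set of constraints and a set of simple equalities. -/
structure Subproblem where
  C : Finset Constraint
  D : Finset SimpleEq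
  deriving DecidableEq

/-- The assignment satisfies all constraints and all simple equalities of the subproblem. -/
def Subproblem.Sat (p : Subproblem) (A : Assignment) : Prop :=
  (∀ c ∈ p.C, c.Sat A) ∧ ∀ d ∈ p.D, d.toConstraint.Sat A

/-- The second component of a state: no assignment, an assignment, or an assignment annotated
with the superscript `-∞`. -/
inductive Incumbent where
  | none
  | some (A : Assignment)
  | negInf (A : Assignment)

/-- The objective value of the second component of a state. -/
noncomputable def Incumbent.obj (O : LinExpr) : Incumbent → EReal
  | .none => ⊤
  | .some A => ((O.eval A : ℝ) : EReal)
  | .negInf _ => ⊥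

/-- A state. -/
structure State where
  P : Finset Subproblem
  A : Incumbent

/-- `lb` is a lower-bounding function for the objective function `O`. -/
def IsLowerBounding (O : LinExpr) (lb : Subproblem → EReal) : Prop :=
  ∀ (p : Subproblem) (A : Assignment), p.Sat A → lb p ≤ ((O.eval A : ℝ) : EReal)

variable {L : FirstOrder.Language.{0, 0}}

/-- The formulas of the subproblem. -/
def Subproblem.formulas (L : FirstOrder.Language.{0, 0}) (p : Subproblem) :
    Set ((intLang.sum L).Formula ℕ) :=
  cFormulas L p.C ∪ dFormulas L p.D

/-- `A` is a `T`-model of the subproblem and the interface atoms: `A` satisfies the constraints,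
and the formulas `v = A(v)` and the interface atoms are satisfiable together with linear integer
arithmetic and `T`. -/
def IsTModel (T : L.Theory) (Q : Instance L) (p : Subproblem) (A : Assignment) : Prop :=
  p.Sat A ∧ Satisfiable (zTheory L ∪ tTheory T) (aFormulas L A ∪ Q.iFormulas)

/-- The transition relation, for the theory `T`, the instance `Q` (of which only the interface
atoms and the objective function matter) and the lower-bounding function `lb`. -/
inductive Step (T : L.Theory) (Q : Instance L) (lb : Subproblem → EReal) : State → State → Prop
  | branch (P : Finset Subproblem) (p : Subproblem) (A : Incumbent)
      (Cs : Finset (Finset Constraint)) (hp : p ∉ P) (hn : 1 < Cs.card)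
      (h : Entails (zTheory L) (dFormulas L p.D)
        ((cConj L p.C).iff (FirstOrder.Language.Formula.iSup fun C : Cs => cConj L C.1))) :
      Step T Q lb ⟨insert p P, A⟩ ⟨P ∪ Cs.image fun C => ⟨C, p.D⟩, A⟩
  | learn (P : Finset Subproblem) (p : Subproblem) (A : Incumbent) (c : Constraint)
      (hp : p ∉ P) (hc : c ∉ p.C)
      (h : Entails (zTheory L) (p.formulas L) (c.toFormula L)) :
      Step T Q lb ⟨insert p P, A⟩ ⟨insert ⟨insert c p.C, p.D⟩ P, A⟩
  | forget (P : Finset Subproblem) (p : Subproblem) (A : Incumbent) (c : Constraint)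
      (hp : ⟨insert c p.C, p.D⟩ ∉ P) (hc : c ∉ p.C)
      (h : Entails (zTheory L) (p.formulas L) (c.toFormula L)) :
      Step T Q lb ⟨insert ⟨insert c p.C, p.D⟩ P, A⟩ ⟨insert p P, A⟩
  | propagate (P : Finset Subproblem) (p : Subproblem) (A : Incumbent) (d : SimpleEq)
      (hp : p ∉ P) (hd : d ∉ p.D)
      (h : Entails (zTheory L) (p.formulas L) (d.toConstraint.toFormula L)) :
      Step T Q lb ⟨insert p P, A⟩ ⟨insert ⟨p.C, insert d p.D⟩ P, A⟩
  | drop (P : Finset Subproblem) (p : Subproblem) (A : Incumbent) (hp : p ∉ P)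
      (h : ∀ B : Assignment, ¬ p.Sat B) :
      Step T Q lb ⟨insert p P, A⟩ ⟨P, A⟩
  | prune (P : Finset Subproblem) (p : Subproblem) (A : Incumbent) (hp : p ∉ P)
      (hA : A ≠ .none) (h : A.obj Q.objective ≤ lb p) :
      Step T Q lb ⟨insert p P, A⟩ ⟨P, A⟩
  | retire (P : Finset Subproblem) (p : Subproblem) (A : Incumbent) (A' : Assignment)
      (hp : p ∉ P) (hA' : IsTModel T Q p A')
      (hlt : (Incumbent.some A').obj Q.objective < A.obj Q.objective)
      (hopt : ∀ B : Assignment, IsTModel T Q p B → Q.objective.eval A' ≤ Q.objective.eval B) :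
      Step T Q lb ⟨insert p P, A⟩ ⟨P, .some A'⟩
  | unbounded (P : Finset Subproblem) (p : Subproblem) (A : Incumbent) (A' : Assignment)
      (hp : p ∉ P) (hA' : IsTModel T Q p A')
      (hle : (Incumbent.some A').obj Q.objective ≤ A.obj Q.objective)
      (hunb : ∀ k : ℤ, ∃ B : Assignment, IsTModel T Q p B ∧ Q.objective.eval B < k) :
      Step T Q lb ⟨insert p P, A⟩ ⟨∅, .negInf A'⟩
  | tLearn (P : Finset Subproblem) (p : Subproblem) (A : Incumbent) (c : Constraint)
      (hp : p ∉ P) (hc : c ∉ p.C)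
      (h : ∃ F : (intLang.sum L).Formula ℕ, Entails (zTheory L) (p.formulas L) F ∧
        Entails (tTheory T) ({F} ∪ Q.iFormulas) (c.toFormula L)) :
      Step T Q lb ⟨insert p P, A⟩ ⟨insert ⟨insert c p.C, p.D⟩ P, A⟩

/-- The subproblem that consists of the constraints of the instance. -/
def Instance.root (Q : Instance L) : Subproblem := ⟨Q.constraints.toFinset, ∅⟩

/-- The starting state of the instance. -/
def Instance.start (Q : Instance L) : State := ⟨{Q.root}, .none⟩

/-- What the second component of a final state reports is true: the instance has no `T`-model; or
the assignment is an optimal `T`-model; or it is a `T`-model and the objective function takes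
arbitrarily low values on `T`-models. -/
def Instance.Correct (T : L.Theory) (Q : Instance L) : Incumbent → Prop
  | .none => ∀ B : Assignment, ¬ IsTModel T Q Q.root B
  | .some A => IsTModel T Q Q.root A ∧
      ∀ B : Assignment, IsTModel T Q Q.root B → Q.objective.eval A ≤ Q.objective.eval B
  | .negInf A => IsTModel T Q Q.root A ∧
      ∀ k : ℤ, ∃ B : Assignment, IsTModel T Q Q.root B ∧ Q.objective.eval B < k

/-- The finite sequence of states is a run from the starting state of the instance to a final
state with a correct report. -/
def IsCompleteRun (T : L.Theory) (Q : Instance L) (lb : Subproblem → EReal)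
    (run : List State) : Prop :=
  run.head? = some Q.start ∧ run.IsChain (Step T Q lb) ∧
    ∃ A : Incumbent, run.getLast? = some ⟨∅, A⟩ ∧ Q.Correct T A

end System

section Coding

/-! ### Finite codes, on which algorithms work -/

/-- The five relations are numbered. -/
def Rel.equivFin : Rel ≃ Fin 5 where
  toFun
    | .lt => 0
    | .le => 1
    | .eq => 2
    | .gt => 3
    | .ge => 4
  invFun i := match i with
    | 0 => .lt
    | 1 => .le
    | 2 => .eq
    | 3 => .gt
    | 4 => .ge
  left_inv r := by cases r <;> rfl
  right_inv i := by fin_cases i <;> rfl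

instance Rel.primcodable : Primcodable Rel := Primcodable.ofEquiv (Fin 5) Rel.equivFin

/-- A simple equality is a tuple of numbers. -/
def SimpleEq.equivSum : SimpleEq ≃ (ℕ × ℤ) ⊕ (ℕ × ℕ × ℤ) where
  toFun
    | .single v c => .inl (v, c)
    | .diff v w c => .inr (v, w, c)
  invFun
    | .inl (v, c) => .single v c
    | .inr (v, w, c) => .diff v w c
  left_inv d := by cases d <;> rfl
  right_inv x := by rcases x with ⟨v, c⟩ | ⟨v, w, c⟩ <;> rfl

instance SimpleEq.primcodable : Primcodable SimpleEq :=
  Primcodable.ofEquiv ((ℕ × ℤ) ⊕ (ℕ × ℕ × ℤ)) SimpleEq.equivSum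

/-- Codes of subproblems and states: finite sets are listed, and an assignment is given by the
list of its values on the first variables, all further values being `0`. The Boolean is the
annotation `-∞`. -/
abbrev StateCode := List (List Constraint × List SimpleEq) × Option (Bool × List ℤ)

/-- The state with the given code. -/
def StateCode.toState (s : StateCode) : State where
  P := (s.1.map fun p => (⟨p.1.toFinset, p.2.toFinset⟩ : Subproblem)).toFinset
  A := match s.2 with
    | none => .none
    | some (false, l) => .some fun v => l.getD v 0
    | some (true, l) => .negInf fun v => l.getD v 0

variable (L : FirstOrder.Language.{0, 0})

/-- Codes of terms: words in prefix notation over the variables and the function symbols. -/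
abbrev TermCode := List (ℕ ⊕ (Σ n, L.Functions n))

/-- Codes of atoms: the predicate symbol, or nothing for an equality, and the arguments. -/
abbrev AtomCode := Option (Σ n, L.Relations n) × List (TermCode L)

/-- Codes of instances. -/
abbrev InstanceCode := List Constraint × List (AtomCode L × Option ℕ) × LinExpr

variable {L}

/-- The code of an atom. -/
def Atom.code : Atom L → AtomCode L
  | .eq s t => (none, [s.listEncode, t.listEncode])
  | .rel (n := n) R ts => (some ⟨n, R⟩, List.ofFn fun i => (ts i).listEncode)

/-- The code of an instance. -/
def Instance.code (Q : Instance L) : InstanceCode L :=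
  (Q.constraints, Q.interface.map fun a => (a.atom.code, a.ann), Q.objective)

/-- A literal: an atom (with the Boolean `true`) or the negation of an atom (with `false`). -/
def literalFormula (l : Bool × Atom L) : L.Formula ℕ :=
  match l with
  | (true, a) => a.toFormula
  | (false, a) => a.toFormula.not

/-- `T` is decidable: an algorithm decides the `T`-satisfiability of finite conjunctions of
literals. -/
def DecidableTheory [Primcodable (Σ n, L.Functions n)] [Primcodable (Σ n, L.Relations n)]
    (T : L.Theory) : Prop :=
  ∃ d : List (Bool × AtomCode L) → Bool, Computable d ∧
    ∀ Γ : List (Bool × Atom L), d (Γ.map fun l => (l.1, l.2.code)) = true ↔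
      Satisfiable T {φ | ∃ l ∈ Γ, φ = literalFormula l}

end Coding

end IMT

/-!
Every run that the algorithm outputs consists of at most three states, because the rules Retire and
Unbounded may be applied to the root subproblem itself, and because `T`-Learn may use any formula
`F` that follows from the constraints.

* If no `T`-model exists, then arithmetic, `T`, the constraints and the interface atoms have no
  common model (`exists_sat_agrees_of_satisfiable`; this uses that arithmetic is a complete theory).
  By compactness finitely many sentences of arithmetic suffice for the contradiction, and their
  conjunction with the constraints is an interpolant `F` from which `T`-Learn derives any
  constraint, in particular one without solutions (`exists_interpolant_of_not_satisfiable`). Then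
  Drop applies.
* If `T`-models have a least objective value, then Retire applies, and otherwise Unbounded.

What remains is to decide which case holds, and to find the `T`-model.

*`T`-models.* Whether an assignment is compatible with the interface atoms depends only on the
arrangement of the finitely many variables that occur (which of them are equal) and on the signs of
the annotations; these are expressed by literals, so `T`-models are recognized by the decision
procedure for `T`. This is the Nelson-Oppen combination (`isTModel_iff`): as `T` is stably infinite
and the signature is countable, the literals have a denumerable model of `T`, which is carried to
the integers along a bijection that sends the value of each variable to its value under the
assignment (`satisfiable_of_agrees`).

*Small solutions.* A multiset of integers of absolute value at most `a` with sum zero has a nonempty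
submultiset of at most `2 * a + 1` members with sum zero: order the members such that the partial
sums stay in `[-a, a]`, and use the pigeonhole principle. Hence, if all elements of a monoid of
integer vectors are sums of elements of size at most `B`, then this also holds, with an explicit
larger bound, for the elements on which a given linear functional is nonnegative
(`BoundedlyGenerated.nonnegPart`). Iterating this over the homogenized constraints shows that
every solution is the sum of a small solution and of directions that may be repeated at will
(`exists_small_solution_add_directions`). The bound depends only on the number and the weights of
the constraints, so it can be chosen uniformly for all arrangements
(`Compatible.exists_small_add_directions`). Consequently the existence of a `T`-model is decided by
a search in a box, and a `T`-model below the values of all small ones shows that the objective is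
unbounded (`Compatible.unbounded`).

*The algorithm.* If there is a small `T`-model, then all lists of integers are searched for a
`T`-model that is lower than all small ones, or that cannot be improved; the latter is a question
of the same kind, with one more constraint. If the first alternative never occurs, the values are
bounded below, so the second one does (`exists_mem_searchStep`).
-/

open scoped FirstOrder

namespace IMT

/-! ### Bounded generation of integer cones -/

section ZeroSum

variable {ι : Type*}

/-- Elements of a multiset of bounded integers with sum `-s` can be listed such that all partial
sums, started at `s`, stay bounded: take a nonnegative element next if the current sum is not
positive, and a nonpositive one otherwise. -/
theorem exists_list_partial_sums_le (w : ι → ℤ) (a : ℤ) (S : Multiset ι) :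
    ∀ s : ℤ, (∀ x ∈ S, |w x| ≤ a) → |s| ≤ a → s + (S.map w).sum = 0 →
      ∃ l : List ι, (l : Multiset ι) = S ∧ ∀ k, |s + ((l.take k).map w).sum| ≤ a := by
  classical
  induction hn : S.card generalizing S with
  | zero =>
    intro s _ hs _
    rw [Multiset.card_eq_zero] at hn
    subst hn
    exact ⟨[], rfl, by simpa using hs⟩
  | succ n ih =>
    intro s hS hs h0
    obtain ⟨x, hx, hxs⟩ : ∃ x ∈ S, |s + w x| ≤ a := by
      by_cases h : s ≤ 0
      · obtain ⟨x, hx, hx0⟩ : ∃ x ∈ S, 0 ≤ w x := by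
          by_contra! hc
          have : (S.map w).sum < (S.map fun _ => (0 : ℤ)).sum :=
            Multiset.sum_lt_sum_of_nonempty (by rintro rfl; simp at hn) hc
          simp at this
          omega
        refine ⟨x, hx, ?_⟩
        have := hS x hx
        rw [abs_le] at *
        constructor <;> omega
      · obtain ⟨x, hx, hx0⟩ : ∃ x ∈ S, w x ≤ 0 := by
          by_contra! hc
          have : (S.map fun _ => (0 : ℤ)).sum < (S.map w).sum :=
            Multiset.sum_lt_sum_of_nonempty (by rintro rfl; simp at hn) hc
          simp at this
          omega
        refine ⟨x, hx, ?_⟩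
        have := hS x hx
        rw [abs_le] at *
        constructor <;> omega
    have hxS := Multiset.cons_erase hx
    have hsum : (S.map w).sum = w x + ((S.erase x).map w).sum := by
      conv_lhs => rw [← hxS]
      simp
    obtain ⟨l, hl, hk⟩ := ih (S.erase x) (by rw [Multiset.card_erase_of_mem hx, hn]; rfl) (s + w x)
      (fun y hy => hS y (Multiset.mem_of_mem_erase hy)) hxs (by rw [← h0, hsum]; ring)
    refine ⟨x :: l, by rw [← hxS, ← hl]; rfl, fun k => ?_⟩
    cases k with
    | zero => simpa using hs
    | succ k => simpa [add_assoc] using hk k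

/-- By the pigeonhole principle, two of the first `2 * a + 2` partial sums agree. -/
theorem exists_zero_sum_submultiset (w : ι → ℤ) (a : ℕ) (S : Multiset ι)
    (hS : ∀ x ∈ S, |w x| ≤ a) (h0 : (S.map w).sum = 0) (hne : S ≠ 0) :
    ∃ T ≤ S, T ≠ 0 ∧ T.card ≤ 2 * a + 1 ∧ (T.map w).sum = 0 := by
  by_cases hc : S.card ≤ 2 * a + 1
  · exact ⟨S, le_rfl, hne, hc, h0⟩
  push Not at hc
  obtain ⟨l, rfl, hl⟩ := exists_list_partial_sums_le w a S 0 hS (by simp) (by simpa using h0)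
  simp only [zero_add, Multiset.coe_card] at hl hc
  have hpig : ∃ i ∈ Finset.range (2 * a + 2), ∃ j ∈ Finset.range (2 * a + 2), i ≠ j ∧
      ((l.take i).map w).sum = ((l.take j).map w).sum := by
    apply Finset.exists_ne_map_eq_of_card_lt_of_maps_to (t := Finset.Icc (-(a : ℤ)) a)
    · simp; omega
    · intro k _
      have := hl k
      rw [abs_le] at this
      simpa using this
  have key : ∀ i j, i < j → j < 2 * a + 2 →
      ((l.take i).map w).sum = ((l.take j).map w).sum →
      ∃ T ≤ (l : Multiset ι), T ≠ 0 ∧ T.card ≤ 2 * a + 1 ∧ (T.map w).sum = 0 := by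
    intro i j hij hj h
    have hlen : ((l.take j).drop i).length = j - i := by
      rw [List.length_drop, List.length_take]; omega
    refine ⟨((l.take j).drop i : List ι), ?_, ?_, ?_, ?_⟩
    · exact Multiset.coe_le.2 (((l.take j).drop_sublist i).trans (l.take_sublist j)).subperm
    · intro h'
      rw [Multiset.coe_eq_zero] at h'
      rw [h'] at hlen
      simp at hlen
      omega
    · rw [Multiset.coe_card, hlen]; omega
    · have h2 : l.take j = l.take i ++ (l.take j).drop i := by
        conv_lhs => rw [← List.take_append_drop i (l.take j)]
        rw [List.take_take, min_eq_left hij.le]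
      rw [h2, List.map_append, List.sum_append] at h
      simpa using h
  obtain ⟨i, hi, j, hj, hne, h⟩ := hpig
  rw [Finset.mem_range] at hi hj
  rcases lt_or_gt_of_ne hne with hij | hij
  · exact key i j hij hj h
  · exact key j i hij hi h.symm

/-- Slack elements of weight `-1` reduce nonnegative sums to sums that are zero. -/
theorem exists_nonneg_submultiset (w : ι → ℤ) (a : ℕ) (ha : 0 < a) (S : Multiset ι)
    (hS : ∀ x ∈ S, |w x| ≤ a) (h0 : 0 ≤ (S.map w).sum) (hne : S ≠ 0) :
    ∃ T ≤ S, T ≠ 0 ∧ T.card ≤ 2 * a + 1 ∧ 0 ≤ (T.map w).sum ∧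
      (T.map w).sum ≤ (S.map w).sum := by
  classical
  obtain ⟨σ, hσ⟩ := Int.eq_ofNat_of_zero_le h0
  let w' : Option ι → ℤ := fun o => o.elim (-1) w
  have hw' : ∀ U : Multiset (Option ι),
      (U.map w').sum = ((U.filterMap id).map w).sum - U.count none := by
    intro U
    induction U using Multiset.induction_on with
    | empty => simp
    | cons o U ih =>
      cases o with
      | none => rw [Multiset.filterMap_cons_none _ _ rfl]; simp [ih, w']; ring
      | some x => rw [Multiset.filterMap_cons_some id _ _ rfl]; simp [ih, w']; ring
  let S' : Multiset (Option ι) := S.map some + Multiset.replicate σ none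
  have hfS' : S'.filterMap id = S := by
    simp only [S', Multiset.filterMap_add, Multiset.filterMap_map]
    have h1 : Multiset.filterMap id (Multiset.replicate σ (none : Option ι)) = 0 := by
      rw [Multiset.eq_zero_iff_forall_notMem]
      intro x hx
      rw [Multiset.mem_filterMap] at hx
      obtain ⟨o, ho, hox⟩ := hx
      rw [Multiset.eq_of_mem_replicate ho] at hox
      simp at hox
    rw [h1, add_zero]
    exact Multiset.filterMap_some S
  have hcS' : S'.count none = σ := by
    simp [S']
  obtain ⟨T, hT, hT0, hTc, hTs⟩ := exists_zero_sum_submultiset w' a S'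
    (by
      intro o ho
      simp only [S', Multiset.mem_add, Multiset.mem_map] at ho
      rcases ho with ⟨x, hx, rfl⟩ | ho
      · exact hS x hx
      · rw [Multiset.eq_of_mem_replicate ho]
        simp [w']
        omega)
    (by rw [hw', hfS', hcS', hσ]; simp)
    (by
      intro h
      apply hne
      rw [← hfS', h]
      simp)
  rw [hw'] at hTs
  have hcT : T.count none ≤ σ := hcS' ▸ Multiset.count_le_of_le none hT
  refine ⟨T.filterMap id, ?_, ?_, ?_, ?_, ?_⟩
  · rw [← hfS']
    exact Multiset.filterMap_le_filterMap id hT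
  · intro h
    rw [h] at hTs
    have h2 : T.count none = 0 := by simpa using hTs
    apply hT0
    rw [Multiset.eq_zero_iff_forall_notMem]
    intro o ho
    cases o with
    | none => exact (Multiset.count_eq_zero.1 h2) ho
    | some x =>
      have : x ∈ T.filterMap id := (Multiset.mem_filterMap id T).2 ⟨some x, ho, rfl⟩
      rw [h] at this
      simp at this
  · refine le_trans ?_ hTc
    induction T using Quotient.inductionOn with
    | _ l => exact List.length_filterMap_le id l
  · omega
  · omega

/-- A multiset of bounded integers with nonnegative sum splits into small parts with nonnegative
sums. -/
theorem exists_nonneg_partition (w : ι → ℤ) (a : ℕ) (ha : 0 < a) (S : Multiset ι)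
    (hS : ∀ x ∈ S, |w x| ≤ a) (h0 : 0 ≤ (S.map w).sum) :
    ∃ P : Multiset (Multiset ι), P.sum = S ∧
      ∀ T ∈ P, T.card ≤ 2 * a + 1 ∧ 0 ≤ (T.map w).sum := by
  classical
  induction hn : S.card using Nat.strong_induction_on generalizing S with
  | _ n ih =>
    by_cases hne : S = 0
    · exact ⟨0, by simp [hne], by simp⟩
    obtain ⟨T, hT, hT0, hTc, hTs, hTS⟩ := exists_nonneg_submultiset w a ha S hS h0 hne
    obtain ⟨U, rfl⟩ := Multiset.le_iff_exists_add.1 hT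
    have hTpos : 0 < T.card := Multiset.card_pos.2 hT0
    obtain ⟨P, hP, hP'⟩ := ih U.card (by rw [← hn, Multiset.card_add]; omega) U
      (fun x hx => hS x (Multiset.mem_add.2 (.inr hx)))
      (by rw [Multiset.map_add, Multiset.sum_add] at hTS; omega) rfl
    refine ⟨T ::ₘ P, by rw [Multiset.sum_cons, hP], fun T' hT' => ?_⟩
    rcases Multiset.mem_cons.1 hT' with rfl | h
    · exact ⟨hTc, hTs⟩
    · exact hP' T' h

end ZeroSum

section Cone

variable {V : Type*} [AddCommMonoid V]

/-- Every element of `X` is a sum of elements of `X` of size at most `B`. -/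
def BoundedlyGenerated (size : V → ℕ) (X : AddSubmonoid V) (B : ℕ) : Prop :=
  ∀ x ∈ X, ∃ m : Multiset V, m.sum = x ∧ ∀ y ∈ m, y ∈ X ∧ size y ≤ B

/-- The part of a submonoid on which a functional is nonnegative. -/
def nonnegPart (X : AddSubmonoid V) (w : V →+ ℤ) : AddSubmonoid V where
  carrier := {x | x ∈ X ∧ 0 ≤ w x}
  zero_mem' := ⟨X.zero_mem, by simp⟩
  add_mem' hx hy := ⟨X.add_mem hx.1 hy.1, by rw [map_add]; exact add_nonneg hx.2 hy.2⟩

theorem size_multiset_sum_le {size : V → ℕ} (h0 : size 0 = 0)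
    (hadd : ∀ x y, size (x + y) ≤ size x + size y) (B : ℕ) (m : Multiset V)
    (hm : ∀ y ∈ m, size y ≤ B) : size m.sum ≤ m.card * B := by
  induction m using Multiset.induction_on with
  | empty => simp [h0]
  | cons x m ih =>
    rw [Multiset.sum_cons, Multiset.card_cons, add_mul, one_mul, add_comm (m.card * B)]
    exact (hadd _ _).trans (add_le_add (hm x (by simp)) (ih fun y hy => hm y (by simp [hy])))

theorem BoundedlyGenerated.nonnegPart {size : V → ℕ} (h0 : size 0 = 0)
    (hadd : ∀ x y, size (x + y) ≤ size x + size y) {X : AddSubmonoid V} {B : ℕ} (hB : 0 < B)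
    (hX : BoundedlyGenerated size X B) (w : V →+ ℤ) {a : ℕ} (ha : 0 < a)
    (hw : ∀ x ∈ X, |w x| ≤ a * size x) :
    BoundedlyGenerated size (nonnegPart X w) ((2 * (a * B) + 1) * B) := by
  rintro x ⟨hx, hx0⟩
  obtain ⟨m, rfl, hm⟩ := hX x hx
  obtain ⟨P, rfl, hP⟩ := exists_nonneg_partition w (a * B) (Nat.mul_pos ha hB) m
    (fun y hy => (hw y (hm y hy).1).trans (by
      push_cast
      exact mul_le_mul_of_nonneg_left (by exact_mod_cast (hm y hy).2) (by positivity)))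
    (by rwa [map_multiset_sum] at hx0)
  have hmem : ∀ T ∈ P, ∀ y ∈ T, y ∈ X ∧ size y ≤ B := fun T hT y hy =>
    hm y (Multiset.mem_join.2 ⟨T, hT, hy⟩)
  refine ⟨P.map Multiset.sum, ?_, ?_⟩
  · exact (Multiset.sum_join (S := P)).symm
  · intro y hy
    obtain ⟨T, hT, rfl⟩ := Multiset.mem_map.1 hy
    refine ⟨⟨AddSubmonoid.multiset_sum_mem _ _ fun y hy => (hmem T hT y hy).1, ?_⟩, ?_⟩
    · rw [map_multiset_sum]
      exact (hP T hT).2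
    · exact (size_multiset_sum_le h0 hadd B T fun y hy => (hmem T hT y hy).2).trans
        (Nat.mul_le_mul_right _ (hP T hT).1)

/-- The bound on the size of generators after `m` functionals with coefficient sum at most `a`
have been required to be nonnegative. -/
def genBound (a m : ℕ) : ℕ := m.rec 1 fun _ B => (2 * (a * B) + 1) * B

theorem genBound_pos (a m : ℕ) : 0 < genBound a m := by
  induction m with
  | zero => exact Nat.one_pos
  | succ m ih => exact Nat.mul_pos (Nat.succ_pos _) ih

theorem boundedlyGenerated_foldr {size : V → ℕ} (h0 : size 0 = 0)
    (hadd : ∀ x y, size (x + y) ≤ size x + size y) {X : AddSubmonoid V}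
    (hX : BoundedlyGenerated size X 1) {a : ℕ} (ha : 0 < a) (ws : List (V →+ ℤ))
    (hw : ∀ w ∈ ws, ∀ x ∈ X, |w x| ≤ a * size x) :
    ∃ Y : AddSubmonoid V, (∀ x, x ∈ Y ↔ x ∈ X ∧ ∀ w ∈ ws, 0 ≤ w x) ∧
      BoundedlyGenerated size Y (genBound a ws.length) := by
  induction ws with
  | nil => exact ⟨X, by simp, hX⟩
  | cons w ws ih =>
    obtain ⟨Y, hY, hYg⟩ := ih fun w' hw' => hw w' (by simp [hw'])
    refine ⟨IMT.nonnegPart Y w, fun x => ?_, ?_⟩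
    · change (x ∈ Y ∧ 0 ≤ w x) ↔ _
      rw [hY]
      simp only [List.mem_cons, forall_eq_or_imp]
      tauto
    · exact hYg.nonnegPart h0 hadd (genBound_pos _ _) w ha fun x hx =>
        hw w (by simp) x ((hY x).1 hx).1

end Cone

/-! ### Small generators for integer linear constraints -/

section Constraints

/-- The sum of the absolute values of the coefficients. -/
def LinExpr.weight (e : LinExpr) : ℕ := (e.map fun p => p.1.natAbs).sum

/-- A positive bound on the coefficients of the homogenized constraint. -/
def Constraint.weight (c : Constraint) : ℕ := LinExpr.weight c.1 + c.2.2.natAbs + 1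

/-- Evaluation of a linear expression, as an additive map of the assignment. -/
def LinExpr.evalHom (e : LinExpr) : Assignment →+ ℤ where
  toFun := LinExpr.eval e
  map_zero' := by
    induction e with
    | nil => rfl
    | cons p e ih => simp [LinExpr.eval]
  map_add' A B := by
    induction e with
    | nil => rfl
    | cons p e ih =>
      simp only [LinExpr.eval, List.map_cons, List.sum_cons, Pi.add_apply] at ih ⊢
      rw [ih]
      ring

theorem LinExpr.eval_add (e : LinExpr) (A B : Assignment) :
    e.eval (A + B) = e.eval A + e.eval B := e.evalHom.map_add A B

theorem LinExpr.eval_sum (e : LinExpr) (G : Multiset Assignment) :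
    e.eval G.sum = (G.map e.eval).sum := map_multiset_sum e.evalHom G

/-- The homogenized row `(t, A) ↦ ρ * t + s * e(A)`. -/
def rowHom (ρ s : ℤ) (e : LinExpr) : ℤ × Assignment →+ ℤ :=
  (AddMonoidHom.mulLeft ρ).comp (AddMonoidHom.fst ℤ Assignment) +
    (AddMonoidHom.mulLeft s).comp (e.evalHom.comp (AddMonoidHom.snd ℤ Assignment))

theorem rowHom_apply (ρ s : ℤ) (e : LinExpr) (x : ℤ × Assignment) :
    rowHom ρ s e x = ρ * x.1 + s * e.eval x.2 := rfl

/-- The two rows of a homogenized constraint. Both are the same for an inequality. -/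
def Constraint.rows (c : Constraint) : List (ℤ × ℤ) :=
  match c.2.1 with
  | .lt => [(c.2.2 - 1, -1), (c.2.2 - 1, -1)]
  | .le => [(c.2.2, -1), (c.2.2, -1)]
  | .eq => [(c.2.2, -1), (-c.2.2, 1)]
  | .gt => [(-(c.2.2 + 1), 1), (-(c.2.2 + 1), 1)]
  | .ge => [(-c.2.2, 1), (-c.2.2, 1)]

theorem Constraint.length_rows (c : Constraint) : c.rows.length = 2 := by
  unfold Constraint.rows
  split <;> rfl

theorem Constraint.sat_iff_rows (c : Constraint) (A : Assignment) :
    c.Sat A ↔ ∀ p ∈ c.rows, 0 ≤ rowHom p.1 p.2 c.1 (1, A) := by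
  obtain ⟨e, R, r⟩ := c
  cases R <;> simp [Constraint.Sat, Rel.Holds, Constraint.rows, rowHom_apply] <;> omega

theorem Constraint.rows_bound (c : Constraint) :
    ∀ p ∈ c.rows, |p.1| ≤ c.2.2.natAbs + 1 ∧ |p.2| ≤ 1 := by
  obtain ⟨e, R, r⟩ := c
  have h1 := neg_abs_le r
  have h2 := le_abs_self r
  cases R <;> simp [Constraint.rows, abs_le] <;> omega

/-- The sum of the absolute values of `t` and of the first `N` variables. -/
def homSize (N : ℕ) (x : ℤ × Assignment) : ℕ :=
  x.1.natAbs + ∑ i ∈ Finset.range N, (x.2 i).natAbs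

theorem homSize_add (N : ℕ) (x y : ℤ × Assignment) :
    homSize N (x + y) ≤ homSize N x + homSize N y := by
  have h : ∑ i ∈ Finset.range N, ((x + y).2 i).natAbs ≤
      ∑ i ∈ Finset.range N, (x.2 i).natAbs + ∑ i ∈ Finset.range N, (y.2 i).natAbs := by
    rw [← Finset.sum_add_distrib]
    exact Finset.sum_le_sum fun i _ => Int.natAbs_add_le _ _
  have h1 : (x + y).1.natAbs ≤ x.1.natAbs + y.1.natAbs := Int.natAbs_add_le _ _
  unfold homSize
  omega

/-- The homogenized assignments that vanish beyond the first `N` variables. -/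
def supported (N : ℕ) : AddSubmonoid (ℤ × Assignment) where
  carrier := {x | ∀ i, N ≤ i → x.2 i = 0}
  zero_mem' := fun _ _ => rfl
  add_mem' hx hy := fun i hi => by simp [hx i hi, hy i hi]

theorem natAbs_le_homSize {N : ℕ} {x : ℤ × Assignment} (hx : x ∈ supported N) (i : ℕ) :
    (x.2 i).natAbs ≤ homSize N x := by
  by_cases hi : i < N
  · exact (Finset.single_le_sum (f := fun i => (x.2 i).natAbs) (fun _ _ => Nat.zero_le _)
      (Finset.mem_range.2 hi)).trans (Nat.le_add_left _ _)
  · rw [hx i (not_lt.1 hi)]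
    exact Nat.zero_le _

theorem LinExpr.abs_eval_le (e : LinExpr) (A : Assignment) (B : ℕ)
    (hA : ∀ i, (A i).natAbs ≤ B) : |e.eval A| ≤ e.weight * B := by
  induction e with
  | nil => simp [LinExpr.eval, LinExpr.weight]
  | cons p e ih =>
    simp only [LinExpr.eval, LinExpr.weight, List.map_cons, List.sum_cons] at ih ⊢
    refine (abs_add_le _ _).trans ?_
    push_cast
    rw [add_mul]
    refine add_le_add ?_ (by simpa using ih)
    rw [abs_mul]
    refine mul_le_mul_of_nonneg_left ?_ (abs_nonneg _)
    rw [Int.abs_eq_natAbs]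
    exact_mod_cast hA p.2

theorem abs_rowHom_le {N : ℕ} {x : ℤ × Assignment} (hx : x ∈ supported N) (ρ s : ℤ)
    (hs : |s| ≤ 1) (e : LinExpr) {a : ℕ} (ha : |ρ| + e.weight ≤ a) :
    |rowHom ρ s e x| ≤ a * homSize N x := by
  have h1 := e.abs_eval_le x.2 _ (natAbs_le_homSize hx)
  have h2 : |x.1| ≤ homSize N x := by
    rw [Int.abs_eq_natAbs]
    exact_mod_cast Nat.le_add_right _ _
  rw [rowHom_apply]
  calc |ρ * x.1 + s * e.eval x.2| ≤ |ρ| * |x.1| + |s| * |e.eval x.2| := by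
        rw [← abs_mul, ← abs_mul]; exact abs_add_le _ _
    _ ≤ |ρ| * homSize N x + 1 * (e.weight * homSize N x) := by gcongr
    _ = (|ρ| + e.weight) * homSize N x := by ring
    _ ≤ a * homSize N x := by gcongr

theorem exists_multiset_unit_sum {V : Type*} [AddCommGroup V] (P : V → Prop) (u : V) (hu : P u)
    (hu' : P (-u)) (z : ℤ) : ∃ m : Multiset V, m.sum = z • u ∧ ∀ y ∈ m, P y := by
  obtain ⟨n, rfl | rfl⟩ := z.eq_nat_or_neg
  · refine ⟨Multiset.replicate n u, by simp, fun y hy => ?_⟩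
    rwa [Multiset.eq_of_mem_replicate hy]
  · refine ⟨Multiset.replicate n (-u), by simp, fun y hy => ?_⟩
    rwa [Multiset.eq_of_mem_replicate hy]

theorem boundedlyGenerated_supported (N : ℕ) :
    BoundedlyGenerated (homSize N) (supported N) 1 := by
  let P : ℤ × Assignment → Prop := fun y => y ∈ supported N ∧ homSize N y ≤ 1
  have hunit : ∀ i < N, ∀ z : ℤ, z.natAbs = 1 → P (0, Pi.single i z) := by
    intro i hi z hz
    refine ⟨fun j hj => ?_, ?_⟩
    · exact Pi.single_eq_of_ne (by omega) _
    · simp only [homSize, Int.natAbs_zero, zero_add]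
      rw [Finset.sum_eq_single i]
      · simp [hz]
      · intro j _ hj
        simp [Pi.single_eq_of_ne hj]
      · intro h
        exact absurd (Finset.mem_range.2 hi) h
  intro x hx
  have hpre : ∀ n ≤ N, ∃ m : Multiset (ℤ × Assignment),
      m.sum = (x.1, fun i => if i < n then x.2 i else 0) ∧ ∀ y ∈ m, P y := by
    intro n
    induction n with
    | zero =>
      intro _
      obtain ⟨m, hm, hP⟩ := exists_multiset_unit_sum P ((1, 0) : ℤ × Assignment)
        ⟨fun _ _ => rfl, by simp [homSize]⟩ ⟨fun _ _ => by simp, by simp [homSize]⟩ x.1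
      refine ⟨m, ?_, hP⟩
      rw [hm]
      ext <;> simp
    | succ n ih =>
      intro hn
      obtain ⟨m, hm, hP⟩ := ih (by omega)
      obtain ⟨m', hm', hP'⟩ := exists_multiset_unit_sum P
        ((0, Pi.single n 1) : ℤ × Assignment) (hunit n (by omega) 1 rfl)
        (by
          have := hunit n (by omega) (-1) rfl
          rwa [Pi.single_neg] at this
          ) (x.2 n)
      refine ⟨m + m', ?_, fun y hy => ?_⟩
      · rw [Multiset.sum_add, hm, hm']
        ext i
        · simp
        · simp only [Prod.smul_mk, Prod.mk_add_mk, Pi.add_apply, Pi.smul_apply, smul_eq_mul]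
          by_cases hi : i = n
          · subst hi; simp
          · rw [Pi.single_eq_of_ne hi]
            have : i < n ↔ i < n + 1 := by omega
            simp [this]
      · rcases Multiset.mem_add.1 hy with h | h
        · exact hP y h
        · exact hP' y h
  obtain ⟨m, hm, hP⟩ := hpre N le_rfl
  refine ⟨m, ?_, hP⟩
  rw [hm]
  ext i
  · rfl
  · by_cases hi : i < N
    · simp [hi]
    · simp [hi, hx i (not_lt.1 hi)]

/-- A multiset of nonnegative integers with sum `1` has exactly one nonzero member. -/
theorem exists_eq_one_of_sum_eq_one {ι : Type*} (t : ι → ℤ) (m : Multiset ι)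
    (h0 : ∀ y ∈ m, 0 ≤ t y) (h1 : (m.map t).sum = 1) :
    ∃ y m', m = y ::ₘ m' ∧ t y = 1 ∧ ∀ z ∈ m', t z = 0 := by
  induction m using Multiset.induction_on with
  | empty => simp at h1
  | cons y m ih =>
    rw [Multiset.map_cons, Multiset.sum_cons] at h1
    have hy := h0 y (by simp)
    have hnn : ∀ z ∈ m.map t, 0 ≤ z := by
      intro z hz
      obtain ⟨w, hw, rfl⟩ := Multiset.mem_map.1 hz
      exact h0 w (by simp [hw])
    have hm := Multiset.sum_nonneg hnn
    by_cases hy0 : t y = 0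
    · obtain ⟨z, m', rfl, hz, hm'⟩ := ih (fun z hz => h0 z (by simp [hz])) (by omega)
      refine ⟨z, y ::ₘ m', Multiset.cons_swap _ _ _, hz, fun w hw => ?_⟩
      rcases Multiset.mem_cons.1 hw with rfl | h
      · exact hy0
      · exact hm' w h
    · refine ⟨y, m, rfl, by omega, fun z hz => ?_⟩
      have hsum : (m.map t).sum = 0 := by omega
      have := Multiset.single_le_sum hnn (t z) (Multiset.mem_map_of_mem t hz)
      have := h0 z (by simp [hz])
      omega

/-- Every solution of a system of integer linear constraints is the sum of a small solution and
of directions along which the system stays satisfied. The bound depends only on the number and on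
the weights of the constraints. -/
theorem exists_small_solution_add_directions (Cs : List Constraint) (N : ℕ) {a m : ℕ} (ha : 0 < a)
    (hm : 2 * Cs.length + 1 = m)
    (hw : ∀ c ∈ Cs, c.weight ≤ a) (A : Assignment) (hA : ∀ i, N ≤ i → A i = 0)
    (hsat : ∀ c ∈ Cs, c.Sat A) :
    ∃ (g : Assignment) (G : Multiset Assignment), A = g + G.sum ∧
      (∀ i, N ≤ i → g i = 0) ∧ (∀ i, (g i).natAbs ≤ genBound a m) ∧
      ∀ G' : Multiset Assignment, (∀ h ∈ G', h ∈ G) → ∀ c ∈ Cs, c.Sat (g + G'.sum) := by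
  subst hm
  -- the first row requires the homogenizing coordinate `t` to be nonnegative
  let ws : List (ℤ × Assignment →+ ℤ) := rowHom 1 0 [] ::
    Cs.flatMap fun c => c.rows.map fun p => rowHom p.1 p.2 c.1
  have hlen : ws.length = 2 * Cs.length + 1 := by
    simp [ws, List.length_flatMap, Constraint.length_rows, mul_comm]
  obtain ⟨Y, hY, hgen⟩ := boundedlyGenerated_foldr (size := homSize N) (by simp [homSize])
    (homSize_add N) (boundedlyGenerated_supported N) ha ws (by
      intro w hw' x hx
      rcases List.mem_cons.1 hw' with rfl | h
      · exact abs_rowHom_le hx _ _ (by simp) _ (by simp [LinExpr.weight]; omega)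
      · obtain ⟨c, hc, h⟩ := List.mem_flatMap.1 h
        obtain ⟨p, hp, rfl⟩ := List.mem_map.1 h
        obtain ⟨h1, h2⟩ := c.rows_bound p hp
        refine abs_rowHom_le hx _ _ h2 _ ?_
        have := hw c hc
        unfold Constraint.weight at this
        omega)
  have hrow : ∀ x ∈ Y, ∀ c ∈ Cs, ∀ p ∈ c.rows, 0 ≤ rowHom p.1 p.2 c.1 x := fun x hx c hc p hp =>
    ((hY x).1 hx).2 _ (List.mem_cons_of_mem _
      (List.mem_flatMap.2 ⟨c, hc, List.mem_map.2 ⟨p, hp, rfl⟩⟩))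
  have ht : ∀ x ∈ Y, 0 ≤ x.1 := fun x hx => by
    have := ((hY x).1 hx).2 _ List.mem_cons_self
    simpa [rowHom_apply] using this
  have hxY : ((1, A) : ℤ × Assignment) ∈ Y := by
    refine (hY _).2 ⟨hA, fun w hw' => ?_⟩
    rcases List.mem_cons.1 hw' with rfl | h
    · simp [rowHom_apply]
    · obtain ⟨c, hc, h⟩ := List.mem_flatMap.1 h
      obtain ⟨p, hp, rfl⟩ := List.mem_map.1 h
      exact (c.sat_iff_rows A).1 (hsat c hc) p hp
  rw [hlen] at hgen
  obtain ⟨m, hm, hmY⟩ := hgen _ hxY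
  obtain ⟨y, m', rfl, hy, hm'⟩ := exists_eq_one_of_sum_eq_one Prod.fst m
    (fun y hy => ht y (hmY y hy).1)
    (by rw [← AddMonoidHom.coe_fst, ← map_multiset_sum, hm]; rfl)
  have hyY := hmY y (by simp)
  have hys := ((hY y).1 hyY.1).1
  refine ⟨y.2, m'.map Prod.snd, ?_, hys, fun i => (natAbs_le_homSize hys i).trans hyY.2, ?_⟩
  · rw [Multiset.sum_cons] at hm
    have := congrArg Prod.snd hm
    rw [Prod.snd_add] at this
    rw [← AddMonoidHom.coe_snd, ← map_multiset_sum]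
    exact this.symm
  · intro G' hG' c hc
    rw [c.sat_iff_rows]
    intro p hp
    have hG'Y : ∀ h ∈ G', ((0, h) : ℤ × Assignment) ∈ Y := by
      intro h hh
      obtain ⟨z, hz, rfl⟩ := Multiset.mem_map.1 (hG' h hh)
      have := (hmY z (by simp [hz])).1
      rwa [← hm' z hz]
    have : ((1, y.2 + G'.sum) : ℤ × Assignment) =
        y + (G'.map fun h => ((0, h) : ℤ × Assignment)).sum := by
      have hs : (G'.map fun h => ((0, h) : ℤ × Assignment)).sum = (0, G'.sum) :=
        (map_multiset_sum (AddMonoidHom.inr ℤ Assignment) G').symm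
      rw [hs]
      ext
      · simp [hy]
      · simp
    rw [this]
    refine hrow _ (Y.add_mem hyY.1 (AddSubmonoid.multiset_sum_mem _ _ fun z hz => ?_)) c hc p hp
    obtain ⟨h, hh, rfl⟩ := Multiset.mem_map.1 hz
    exact hG'Y h hh

end Constraints

open FirstOrder FirstOrder.Language

/-! ### Transfer between the standard model and models of linear integer arithmetic -/

section Transfer

theorem realize_natMulTerm (n : ℕ) (t : intLang.Term ℕ) (A : Assignment) :
    (natMulTerm n t).realize A = n * t.realize A := by
  induction n with
  | zero =>
    change (0 : ℤ) = (0 : ℕ) * _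
    simp
  | succ n ih =>
    have : (natMulTerm (n + 1) t).realize A = (natMulTerm n t).realize A + t.realize A := rfl
    rw [this, ih]
    push_cast
    ring

theorem realize_intMulTerm (z : ℤ) (t : intLang.Term ℕ) (A : Assignment) :
    (intMulTerm z t).realize A = z * t.realize A := by
  cases z with
  | ofNat n => exact realize_natMulTerm n t A
  | negSucc n =>
    have : (intMulTerm (.negSucc n) t).realize A = -(natMulTerm (n + 1) t).realize A := rfl
    rw [this, realize_natMulTerm, Int.negSucc_eq]
    push_cast
    ring

theorem LinExpr.realize_toTerm (e : LinExpr) (A : Assignment) :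
    (LinExpr.toTerm e).realize A = e.eval A := by
  induction e with
  | nil => rfl
  | cons p e ih =>
    have : (LinExpr.toTerm (p :: e)).realize A =
        (intMulTerm p.1 (.var p.2)).realize A + (LinExpr.toTerm e).realize A := rfl
    rw [this, ih, realize_intMulTerm]
    rfl

theorem realize_leFormula {M : Type} [intLang.Structure M] (s t : intLang.Term ℕ) (v : ℕ → M) :
    (leFormula s t).Realize v ↔ Structure.RelMap leSym ![s.realize v, t.realize v] := by
  rw [leFormula, Formula.realize_rel]
  apply iff_of_eq
  congr 1
  ext i
  fin_cases i <;> rfl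

/-- A constraint as a formula over the signature of linear integer arithmetic. -/
def Constraint.intFormula (c : Constraint) : intLang.Formula ℕ :=
  c.2.1.toFormula (LinExpr.toTerm c.1) (numeral c.2.2)

theorem Constraint.realize_intFormula (c : Constraint) (A : Assignment) :
    c.intFormula.Realize A ↔ c.Sat A := by
  obtain ⟨e, R, r⟩ := c
  have hle : ∀ x y : ℤ, Structure.RelMap leSym ![x, y] ↔ x ≤ y := fun _ _ => Iff.rfl
  have hr : (numeral r).realize A = r := rfl
  cases R <;>
    simp [Constraint.intFormula, Rel.toFormula, Constraint.Sat, Rel.Holds, realize_leFormula,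
      LinExpr.realize_toTerm, hle, hr, Formula.realize_not, Formula.realize_equal]

variable {M : Type} [intLang.Structure M]

/-- Linear integer arithmetic is complete, so satisfiability of a formula does not depend on the
model. -/
theorem exists_realize_iff_of_model [Nonempty M] (hM : M ⊨ intTheory) (φ : intLang.Formula ℕ) :
    (∃ v : ℕ → M, φ.Realize v) ↔ ∃ A : Assignment, φ.Realize A := by
  have h : ∀ (N : Type) [intLang.Structure N] [Nonempty N],
      (∃ v : ℕ → N, φ.Realize v) ↔ N ⊨ φ.exClosure := by
    intro N _ _
    rw [← Formula.exists_realize_equivSentence_iff_realize_exClosure]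
    refine exists_congr fun v => ?_
    let := constantsOn.structure v
    exact (Formula.realize_equivSentence N φ).symm
  rw [h M, h ℤ]
  refine ⟨fun hφ => ?_, fun hφ => (Theory.model_iff _).1 hM _ hφ⟩
  by_contra hc
  have := (Theory.model_iff _).1 hM (∼φ.exClosure) (show _ from by
    rw [intTheory, mem_completeTheory, Sentence.realize_not]
    exact hc)
  rw [Sentence.realize_not] at this
  exact this hφ

theorem realize_of_forall_realize (hM : M ⊨ intTheory) {φ : intLang.Formula ℕ}
    (h : ∀ A : Assignment, φ.Realize A) (v : ℕ → M) : φ.Realize v := by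
  have : Nonempty M := ⟨v 0⟩
  by_contra hc
  obtain ⟨A, hA⟩ := (exists_realize_iff_of_model hM φ.not).1 ⟨v, hc⟩
  exact hA (h A)

/-- If every variable denotes a numeral, then formulas hold as in the standard model. -/
theorem realize_iff_of_numerals (hM : M ⊨ intTheory) (A : Assignment) (v : ℕ → M)
    (hv : ∀ i, (Constraint.intFormula (SimpleEq.single i (A i)).toConstraint).Realize v)
    (φ : intLang.Formula ℕ) : φ.Realize v ↔ φ.Realize A := by
  have key : ∀ ψ : intLang.Formula ℕ, ψ.Realize A → ψ.Realize v := by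
    intro ψ hψ
    -- only the finitely many free variables of `ψ` have to be pinned down by a formula
    let χ : intLang.Formula ℕ := (Formula.iInf fun i : ψ.freeVarFinset =>
      Constraint.intFormula (SimpleEq.single i.1 (A i.1)).toConstraint).imp ψ
    have hχ : χ.Realize v := by
      refine realize_of_forall_realize hM (fun B => ?_) v
      rw [Formula.realize_imp, Formula.realize_iInf]
      intro hB
      have hAB : ∀ i ∈ ψ.freeVarFinset, A i = B i := by
        intro i hi
        have := (Constraint.realize_intFormula _ _).1 (hB ⟨i, hi⟩)
        simpa [Constraint.Sat, Rel.Holds, SimpleEq.toConstraint, LinExpr.eval] using this.symm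
      have hres : ∀ C : Assignment, ψ.Realize C ↔
          (BoundedFormula.restrictFreeVar ψ id).Realize (fun i => C i.1) default := by
        intro C
        rw [Formula.Realize]
        have := (BoundedFormula.realize_restrictFreeVar (M := ℤ) (φ := ψ) (f := id)
          (v := fun i => C i.1) (xs := default) C fun _ => rfl).symm
        convert this
      rw [hres] at hψ ⊢
      convert hψ using 2 with i
      exact (hAB i i.2).symm
    rw [Formula.realize_imp, Formula.realize_iInf] at hχ
    exact hχ fun i => hv i.1
  refine ⟨fun h => ?_, key φ⟩
  by_contra hc
  exact key φ.not hc h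

end Transfer

/-! ### Structures over the combined signature -/

section Sum

variable {L : FirstOrder.Language.{0, 0}}

theorem satisfiable_sum_iff (T : (intLang.sum L).Theory) (Γ : Set ((intLang.sum L).Formula ℕ)) :
    Satisfiable T Γ ↔ ∃ (M : Type) (_ : intLang.Structure M) (_ : L.Structure M) (v : ℕ → M),
      M ⊨ T ∧ ∀ φ ∈ Γ, φ.Realize v := by
  constructor
  · rintro ⟨M, i, v, h⟩
    let i₁ : intLang.Structure M := (LHom.sumInl : intLang →ᴸ intLang.sum L).reduct M
    let i₂ : L.Structure M := (LHom.sumInr : L →ᴸ intLang.sum L).reduct M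
    have hi : i = intLang.sumStructure L M := by
      ext n f
      · cases f <;> rfl
      · cases f <;> rfl
    refine ⟨M, i₁, i₂, v, ?_⟩
    rw [← hi]
    exact h
  · rintro ⟨M, i₁, i₂, v, h⟩
    exact ⟨M, _, v, h⟩

variable {M : Type} [intLang.Structure M] [L.Structure M]

theorem model_zTheory_union_tTheory_iff (T : L.Theory) :
    M ⊨ (zTheory L ∪ tTheory T) ↔ M ⊨ intTheory ∧ M ⊨ T := by
  rw [Theory.model_union_iff, zTheory, tTheory, LHom.onTheory_model, LHom.onTheory_model]

theorem Constraint.realize_toFormula (c : Constraint) (v : ℕ → M) :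
    (c.toFormula L).Realize v ↔ c.intFormula.Realize v :=
  LHom.realize_onFormula _ _

theorem InterfaceAtom.realize_toFormula (a : InterfaceAtom L) (v : ℕ → M) :
    a.toFormula.Realize v ↔ (a.atom.toFormula.Realize v ↔
      ∀ x, a.ann = some x → (Constraint.intFormula ([(1, x)], .gt, 0)).Realize v) := by
  obtain ⟨a, o⟩ := a
  cases o with
  | none => simp [InterfaceAtom.toFormula, LHom.realize_onFormula]
  | some x =>
    simp [InterfaceAtom.toFormula, LHom.realize_onFormula, Formula.realize_iff,
      Constraint.realize_toFormula]

/-- The atoms have the truth values that the annotations prescribe under `A`, and the first `N`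
variables are arranged as under `A`. -/
def Agrees {M : Type} [L.Structure M] (Q : Instance L) (N : ℕ) (A : Assignment) (v : ℕ → M) :
    Prop :=
  (∀ a ∈ Q.interface, a.atom.toFormula.Realize v ↔ ∀ x, a.ann = some x → 0 < A x) ∧
    ∀ i < N, ∀ j < N, v i = v j ↔ A i = A j

theorem realize_gt_zero_intFormula (x : ℕ) (A : Assignment) :
    (Constraint.intFormula ([(1, x)], .gt, 0)).Realize A ↔ 0 < A x := by
  rw [Constraint.realize_intFormula]
  simp [Constraint.Sat, Rel.Holds, LinExpr.eval]

theorem exists_agrees_of_satisfiable (T : L.Theory) (Q : Instance L) (N : ℕ) (A : Assignment)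
    (h : Satisfiable (zTheory L ∪ tTheory T) (aFormulas L A ∪ Q.iFormulas)) :
    ∃ (M : Type) (_ : L.Structure M) (v : ℕ → M), M ⊨ T ∧ Agrees Q N A v := by
  obtain ⟨M, _, _, v, hM, hv⟩ := (satisfiable_sum_iff _ _).1 h
  obtain ⟨hMZ, hMT⟩ := (model_zTheory_union_tTheory_iff T).1 hM
  have hnum := realize_iff_of_numerals hMZ A v fun i =>
    (Constraint.realize_toFormula _ _).1 (hv _ (.inl ⟨i, rfl⟩))
  refine ⟨M, _, v, hMT, fun a ha => ?_, fun i _ j _ => ?_⟩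
  · rw [(a.realize_toFormula v).1 (hv _ (.inr ⟨a, ha, rfl⟩))]
    simp only [hnum, realize_gt_zero_intFormula]
  · have := hnum ((Term.var i).equal (Term.var j))
    simpa [Formula.realize_equal] using this

/-- A common model of arithmetic, `T`, the constraints and the interface atoms yields an integer
assignment with the same arrangement, since arithmetic is complete. -/
theorem exists_sat_agrees_of_satisfiable (T : L.Theory) (Q : Instance L) (N : ℕ)
    (hN : ∀ a ∈ Q.interface, ∀ x, a.ann = some x → x < N) (C : Finset Constraint)
    (h : Satisfiable (zTheory L ∪ tTheory T) (cFormulas L C ∪ Q.iFormulas)) :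
    ∃ (A : Assignment) (M : Type) (_ : L.Structure M) (v : ℕ → M),
      (∀ c ∈ C, c.Sat A) ∧ M ⊨ T ∧ Agrees Q N A v := by
  classical
  obtain ⟨M, _, _, v, hM, hv⟩ := (satisfiable_sum_iff _ _).1 h
  obtain ⟨hMZ, hMT⟩ := (model_zTheory_union_tTheory_iff T).1 hM
  let decided : intLang.Formula ℕ → intLang.Formula ℕ := fun φ => if φ.Realize v then φ else φ.not
  have hdec : ∀ φ, (decided φ).Realize v := by
    intro φ
    by_cases hφ : φ.Realize v
    · simp [decided, hφ]
    · simp [decided, hφ, Formula.realize_not]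
  have hdec' : ∀ φ (A : Assignment), (decided φ).Realize A → (φ.Realize v ↔ φ.Realize A) := by
    intro φ A hA
    by_cases hφ : φ.Realize v
    · simp only [decided, hφ, if_true] at hA
      simp [hφ, hA]
    · simp only [decided, hφ, if_false, Formula.realize_not] at hA
      simp [hφ, hA]
  let χ : intLang.Formula ℕ := (Formula.iInf fun c : C => c.1.intFormula) ⊓
    ((Formula.iInf fun p : Fin N × Fin N =>
      decided ((Term.var (p.1 : ℕ)).equal (Term.var (p.2 : ℕ)))) ⊓
    Formula.iInf fun x : Fin N => decided (Constraint.intFormula ([(1, (x : ℕ))], .gt, 0)))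
  have : Nonempty M := ⟨v 0⟩
  obtain ⟨A, hA⟩ := (exists_realize_iff_of_model hMZ χ).1 ⟨v, by
    simp only [χ, Formula.realize_inf, Formula.realize_iInf]
    exact ⟨fun c => (Constraint.realize_toFormula _ _).1 (hv _ (.inl ⟨c.1, c.2, rfl⟩)),
      fun p => hdec _, fun x => hdec _⟩⟩
  simp only [χ, Formula.realize_inf, Formula.realize_iInf] at hA
  obtain ⟨hC, hE, hS⟩ := hA
  refine ⟨A, M, _, v, fun c hc => (c.realize_intFormula A).1 (hC ⟨c, hc⟩), hMT,
    fun a ha => ?_, fun i hi j hj => ?_⟩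
  · rw [(a.realize_toFormula v).1 (hv _ (.inr ⟨a, ha, rfl⟩))]
    refine forall_congr' fun x => imp_congr_right fun hx => ?_
    rw [hdec' _ A (hS ⟨x, hN a ha x hx⟩), realize_gt_zero_intFormula]
  · have := hdec' _ A (hE (⟨i, hi⟩, ⟨j, hj⟩))
    simpa [Formula.realize_equal] using this

end Sum

/-! ### Combining a model of `T` with the integers -/

section Combination

variable {L : FirstOrder.Language.{0, 0}}

theorem Term.realize_congr_listEncode {M : Type} [L.Structure M] (t : L.Term ℕ) {v w : ℕ → M}
    (h : ∀ i, Sum.inl i ∈ t.listEncode → v i = w i) : t.realize v = t.realize w := by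
  induction t with
  | var i => exact h i (by simp [Term.listEncode])
  | func f ts ih =>
    simp only [Term.realize_func]
    congr 1
    funext k
    refine ih k fun i hi => h i ?_
    simp only [Term.listEncode, List.mem_cons, List.mem_flatMap]
    exact .inr ⟨k, List.mem_finRange k, hi⟩

theorem Atom.realize_congr_code {M : Type} [L.Structure M] (a : Atom L) {v w : ℕ → M}
    (h : ∀ t ∈ a.code.2, ∀ i, Sum.inl i ∈ t → v i = w i) :
    a.toFormula.Realize v ↔ a.toFormula.Realize w := by
  cases a with
  | eq s t =>
    simp only [Atom.toFormula, Formula.realize_equal]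
    rw [Term.realize_congr_listEncode s (h _ (by simp [Atom.code])),
      Term.realize_congr_listEncode t (h _ (by simp [Atom.code]))]
  | rel R ts =>
    simp only [Atom.toFormula, Formula.realize_rel]
    have : ∀ k, (ts k).realize v = (ts k).realize w := fun k =>
      Term.realize_congr_listEncode _ (h _ (by simp [Atom.code]))
    simp only [this]

/-- A bijection between denumerable types can be prescribed on finitely many elements. -/
theorem exists_equiv_int_of_arrangement {M : Type} [Countable M] [Infinite M] (v : ℕ → M)
    (A : Assignment) (N : ℕ) (h : ∀ i < N, ∀ j < N, v i = v j ↔ A i = A j) :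
    ∃ e : M ≃ ℤ, ∀ i < N, e (v i) = A i := by
  induction N with
  | zero => exact ⟨Classical.choice (nonempty_equiv_of_countable (α := M) (β := ℤ)), by simp⟩
  | succ N ih =>
    obtain ⟨e, he⟩ := ih fun i hi j hj => h i (by omega) j (by omega)
    by_cases hc : ∃ i < N, A i = A N
    · obtain ⟨i, hi, hiN⟩ := hc
      refine ⟨e, fun j hj => ?_⟩
      rcases Nat.lt_succ_iff_lt_or_eq.1 hj with hj | rfl
      · exact he j hj
      · rw [← hiN, ← he i hi, (h i (by omega) j (by omega)).2 hiN]
    · push Not at hc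
      refine ⟨e.trans (Equiv.swap (e (v N)) (A N)), fun j hj => ?_⟩
      rcases Nat.lt_succ_iff_lt_or_eq.1 hj with hj | rfl
      · rw [Equiv.trans_apply, Equiv.swap_apply_of_ne_of_ne, he j hj]
        · intro h'
          exact hc j hj ((h j (by omega) N (by omega)).1 (e.injective h'))
        · rw [he j hj]
          exact hc j hj
      · simp

theorem satisfiable_of_agrees [Countable (Σ n, L.Functions n)] [Countable (Σ n, L.Relations n)]
    (T : L.Theory) (Q : Instance L) (N : ℕ)
    (hN : ∀ a ∈ Q.interface, ∀ t ∈ a.atom.code.2, ∀ i, Sum.inl i ∈ t → i < N) (A : Assignment)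
    {M : Type} [L.Structure M] [Infinite M] (hM : M ⊨ T) (v : ℕ → M) (hv : Agrees Q N A v) :
    Satisfiable (zTheory L ∪ tTheory T) (aFormulas L A ∪ Q.iFormulas) := by
  -- a countable elementary substructure that contains the values of all variables
  obtain ⟨S, hvS, hS⟩ := exists_elementarySubstructure_card_eq L (Set.range v) Cardinal.aleph0.{0}
    le_rfl
    (by simpa using Cardinal.mk_le_aleph0_iff.2 (Set.countable_range v).to_subtype)
    (by
      simp only [Cardinal.lift_id]
      exact Cardinal.mk_le_aleph0_iff.2
        (inferInstanceAs (Countable ((Σ n, L.Functions n) ⊕ (Σ n, L.Relations n)))))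
    (by simp)
  simp only [Cardinal.lift_id] at hS
  have : Countable S := Cardinal.mk_le_aleph0_iff.1 hS.le
  have : Infinite S := Cardinal.aleph0_le_mk_iff.1 hS.ge
  let w : ℕ → S := fun i => ⟨v i, hvS ⟨i, rfl⟩⟩
  obtain ⟨e, he⟩ := exists_equiv_int_of_arrangement w A N fun i hi j hj => by
    rw [← hv.2 i hi j hj]
    exact Subtype.ext_iff
  let : L.Structure ℤ := e.inducedStructure
  let g : S ≃[L] ℤ := e.inducedStructureEquiv
  refine (satisfiable_sum_iff _ _).2 ⟨ℤ, intStructure, inferInstance, A, ?_, ?_⟩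
  · rw [model_zTheory_union_tTheory_iff]
    refine ⟨?_, ?_⟩
    · rw [Theory.model_iff]
      exact fun φ hφ => hφ
    · have hST : S ⊨ T := (S.theory_model_iff T).2 hM
      rw [Theory.model_iff] at hST ⊢
      exact fun φ hφ => (StrongHomClass.realize_sentence g φ).1 (hST φ hφ)
  · rintro φ (⟨i, rfl⟩ | ⟨a, ha, rfl⟩)
    · rw [Constraint.realize_toFormula, Constraint.realize_intFormula]
      simp [Constraint.Sat, Rel.Holds, SimpleEq.toConstraint, LinExpr.eval]
    · rw [InterfaceAtom.realize_toFormula]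
      simp only [realize_gt_zero_intFormula]
      rw [← hv.1 a ha]
      have h1 : a.atom.toFormula.Realize A ↔ a.atom.toFormula.Realize (g ∘ w) :=
        a.atom.realize_congr_code fun t ht i hi => (he i (hN a ha t ht i hi)).symm
      rw [h1, StrongHomClass.realize_formula]
      exact (S.subtype.map_formula a.atom.toFormula w).symm

end Combination

/-! ### Compactness -/

section Compactness

variable {K : FirstOrder.Language.{0, 0}}

theorem satisfiable_iff_isSatisfiable (T : K.Theory) (Γ : Set (K.Formula ℕ)) :
    Satisfiable T Γ ↔
      ((K.lhomWithConstants ℕ).onTheory T ∪ Formula.equivSentence '' Γ).IsSatisfiable := by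
  constructor
  · rintro ⟨M, _, v, hT, hΓ⟩
    let := constantsOn.structure v
    have : Nonempty M := ⟨v 0⟩
    have : M ⊨ ((K.lhomWithConstants ℕ).onTheory T ∪ Formula.equivSentence '' Γ) := by
      rw [Theory.model_union_iff, LHom.onTheory_model]
      refine ⟨hT, ?_⟩
      rw [Theory.model_iff]
      rintro _ ⟨φ, hφ, rfl⟩
      exact (Formula.realize_equivSentence M φ).2 (hΓ φ hφ)
    exact Theory.Model.isSatisfiable M
  · rintro ⟨M⟩
    let : K.Structure M := (K.lhomWithConstants ℕ).reduct M
    have hM := M.is_model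
    rw [Theory.model_union_iff, LHom.onTheory_model] at hM
    refine ⟨M, _, fun i => (K.con i : M), hM.1, fun φ hφ => ?_⟩
    exact (Formula.realize_equivSentence M φ).1 ((Theory.model_iff _).1 hM.2 _ ⟨φ, hφ, rfl⟩)

theorem exists_finset_not_satisfiable (T₁ T₂ : K.Theory) (Γ : Set (K.Formula ℕ))
    (h : ¬ Satisfiable (T₁ ∪ T₂) Γ) :
    ∃ T₀ : Finset K.Sentence, (T₀ : Set K.Sentence) ⊆ T₁ ∧ ¬ Satisfiable (↑T₀ ∪ T₂) Γ := by
  classical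
  by_contra! hc
  apply h
  rw [satisfiable_iff_isSatisfiable]
  let F : {T₀ : Finset K.Sentence // (T₀ : Set K.Sentence) ⊆ T₁} → K[[ℕ]].Theory := fun T₀ =>
    (K.lhomWithConstants ℕ).onTheory (↑T₀.1 ∪ T₂) ∪ Formula.equivSentence '' Γ
  have hmono : ∀ S T, S.1 ⊆ T.1 → F S ⊆ F T := fun S T hST =>
    Set.union_subset_union_left _ (Set.image_mono (Set.union_subset_union_left _ hST))
  have : Nonempty {T₀ : Finset K.Sentence // (T₀ : Set K.Sentence) ⊆ T₁} := ⟨⟨∅, by simp⟩⟩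
  have hdir : Directed (· ⊆ ·) F := fun S T =>
    ⟨⟨S.1 ∪ T.1, by rw [Finset.coe_union]; exact Set.union_subset S.2 T.2⟩,
      hmono _ _ Finset.subset_union_left, hmono _ _ Finset.subset_union_right⟩
  refine ((Theory.isSatisfiable_directed_union_iff hdir).2 fun T₀ =>
    (satisfiable_iff_isSatisfiable _ _).1 (hc T₀.1 T₀.2)).mono ?_
  rintro _ (⟨φ, hφ, rfl⟩ | hφ)
  · rcases hφ with hφ | hφ
    · refine Set.mem_iUnion.2 ⟨⟨{φ}, by simpa using hφ⟩, .inl ⟨φ, .inl ?_, rfl⟩⟩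
      simp
    · exact Set.mem_iUnion.2 ⟨⟨∅, by simp⟩, .inl ⟨φ, .inr hφ, rfl⟩⟩
  · exact Set.mem_iUnion.2 ⟨⟨∅, by simp⟩, .inr hφ⟩

theorem exists_conjunction {Γ : Set (K.Formula ℕ)} (hΓ : Γ.Finite) :
    ∃ φ : K.Formula ℕ, ∀ (M : Type) [K.Structure M] (v : ℕ → M),
      φ.Realize v ↔ ∀ ψ ∈ Γ, ψ.Realize v := by
  have := hΓ.to_subtype
  exact ⟨Formula.iInf fun ψ : Γ => ψ.1, fun M _ v => by simp⟩

/-- If the formulas `Γ` and `Δ` have no common model with `T₁` and `T₂`, then an interpolant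
separates them: a finite part of `T₁` together with `Γ`. -/
theorem exists_interpolant_of_not_satisfiable (T₁ T₂ : K.Theory) {Γ : Set (K.Formula ℕ)}
    (hΓ : Γ.Finite) (Δ : Set (K.Formula ℕ)) (h : ¬ Satisfiable (T₁ ∪ T₂) (Γ ∪ Δ))
    (χ : K.Formula ℕ) :
    ∃ F : K.Formula ℕ, Entails T₁ Γ F ∧ Entails T₂ ({F} ∪ Δ) χ := by
  obtain ⟨T₀, hT₀, h0⟩ := exists_finset_not_satisfiable _ _ _ h
  obtain ⟨F, hF⟩ := exists_conjunction
    (Γ := Γ ∪ (fun σ : K.Sentence => Formula.relabel Empty.elim σ) '' (T₀ : Set K.Sentence))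
    (hΓ.union (T₀.finite_toSet.image _))
  have hrel : ∀ (M : Type) [K.Structure M] (v : ℕ → M) (σ : K.Sentence),
      (Formula.relabel Empty.elim σ : K.Formula ℕ).Realize v ↔ M ⊨ σ := by
    intro M _ v σ
    rw [Formula.realize_relabel, Sentence.Realize]
    apply iff_of_eq
    congr 1
    exact Subsingleton.elim _ _
  refine ⟨F, ?_, ?_⟩
  · rintro ⟨M, _, v, hM, hv⟩
    refine hv F.not (.inr rfl) ((hF M v).2 ?_)
    rintro ψ (hψ | ⟨σ, hσ, rfl⟩)
    · exact hv ψ (.inl hψ)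
    · exact (hrel M v σ).2 ((Theory.model_iff _).1 hM σ (hT₀ hσ))
  · rintro ⟨M, _, v, hM, hv⟩
    have hFv := (hF M v).1 (hv F (.inl (.inl rfl)))
    refine h0 ⟨M, inferInstance, v, ?_, ?_⟩
    · rw [Theory.model_union_iff]
      refine ⟨?_, hM⟩
      rw [Theory.model_iff]
      exact fun σ hσ => (hrel M v σ).1 (hFv _ (.inr ⟨σ, hσ, rfl⟩))
    · rintro ψ (hψ | hψ)
      · exact hFv ψ (.inl hψ)
      · exact hv ψ (.inl (.inr hψ))

end Compactness

/-! ### Deciding `T`-models by literals -/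

section Literals

/-- The literals that say that the interface atoms agree with their annotations under `A`, and
that the first `N` variables are arranged as under `A`. The same list is formed of atoms and of
codes of atoms. -/
def literals {α : Type*} (varEq : ℕ → ℕ → α) (N : ℕ) (A : Assignment)
    (I : List (α × Option ℕ)) : List (Bool × α) :=
  (I.map fun p => (p.2.elim true fun x => decide (0 < A x), p.1)) ++
    (List.range N).flatMap fun i => (List.range N).map fun j => (decide (A i = A j), varEq i j)

variable {L : FirstOrder.Language.{0, 0}}

/-- The atom `vᵢ = vⱼ`. -/
def varEqAtom (L : FirstOrder.Language.{0, 0}) (i j : ℕ) : Atom L := .eq (.var i) (.var j)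

/-- The code of the atom `vᵢ = vⱼ`. -/
def varEqCode (L : FirstOrder.Language.{0, 0}) (i j : ℕ) : AtomCode L :=
  (none, [ [Sum.inl i], [Sum.inl j] ])

/-- The literals of an instance. -/
def Instance.literals (Q : Instance L) (N : ℕ) (A : Assignment) : List (Bool × Atom L) :=
  IMT.literals (varEqAtom L) N A (Q.interface.map fun a => (a.atom, a.ann))

theorem Instance.literals_code (Q : Instance L) (N : ℕ) (A : Assignment) :
    (Q.literals N A).map (fun l => (l.1, l.2.code)) =
      IMT.literals (varEqCode L) N A Q.code.2.1 := by
  simp only [Instance.literals, IMT.literals, Instance.code, List.map_append, List.map_map,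
    List.map_flatMap]
  rfl

theorem realize_literalFormula {M : Type} [L.Structure M] (l : Bool × Atom L) (v : ℕ → M) :
    (literalFormula l).Realize v ↔ (l.2.toFormula.Realize v ↔ l.1 = true) := by
  obtain ⟨b, a⟩ := l
  cases b <;> simp [literalFormula, Formula.realize_not]

theorem Instance.realize_literals_iff {M : Type} [L.Structure M] (Q : Instance L) (N : ℕ)
    (A : Assignment) (v : ℕ → M) :
    (∀ l ∈ Q.literals N A, (literalFormula l).Realize v) ↔ Agrees Q N A v := by
  simp only [Instance.literals, IMT.literals, List.mem_append, or_imp, forall_and, Agrees,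
    realize_literalFormula]
  refine and_congr ?_ ?_
  · simp only [List.map_map, List.mem_map, Function.comp_apply, forall_exists_index, and_imp,
      forall_apply_eq_imp_iff₂]
    refine forall₂_congr fun a _ => ?_
    cases a.ann <;> simp
  · simp only [List.mem_flatMap, List.mem_map, List.mem_range]
    constructor
    · intro h i hi j hj
      have := h (decide (A i = A j), varEqAtom L i j) ⟨i, hi, j, hj, rfl⟩
      simpa [varEqAtom, Atom.toFormula, Formula.realize_equal] using this
    · rintro h _ ⟨i, hi, j, hj, rfl⟩
      simpa [varEqAtom, Atom.toFormula, Formula.realize_equal] using h i hi j hj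

/-- Some model of `T` agrees with the assignment on the interface atoms and on the arrangement of
the first `N` variables. -/
def Compatible (T : L.Theory) (Q : Instance L) (N : ℕ) (A : Assignment) : Prop :=
  ∃ (M : Type) (_ : L.Structure M) (v : ℕ → M), M ⊨ T ∧ Agrees Q N A v

theorem satisfiable_literals_iff (T : L.Theory) (Q : Instance L) (N : ℕ) (A : Assignment) :
    Satisfiable T {φ | ∃ l ∈ Q.literals N A, φ = literalFormula l} ↔ Compatible T Q N A := by
  refine exists_congr fun M => exists_congr fun _ => exists_congr fun v => and_congr_right fun _ =>
    Iff.trans ?_ (Q.realize_literals_iff N A v)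
  constructor
  · exact fun h l hl => h _ ⟨l, hl, rfl⟩
  · rintro h _ ⟨l, hl, rfl⟩
    exact h l hl

theorem isQF_literalFormula (l : Bool × Atom L) : (literalFormula l).IsQF := by
  have h : ∀ a : Atom L, a.toFormula.IsQF := by
    rintro (⟨s, t⟩ | ⟨R, ts⟩)
    · exact (BoundedFormula.IsAtomic.equal _ _).isQF
    · exact (BoundedFormula.IsAtomic.rel _ _).isQF
  obtain ⟨b, a⟩ := l
  cases b
  · exact (h a).not
  · exact h a

theorem exists_qf_conjunction (Γ : List (Bool × Atom L)) :
    ∃ φ : L.Formula ℕ, φ.IsQF ∧ ∀ (M : Type) [L.Structure M] (v : ℕ → M),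
      φ.Realize v ↔ ∀ l ∈ Γ, (literalFormula l).Realize v := by
  induction Γ with
  | nil => exact ⟨⊤, BoundedFormula.isQF_bot.not, fun M _ v => by simp⟩
  | cons l Γ ih =>
    obtain ⟨φ, hφ, h⟩ := ih
    refine ⟨literalFormula l ⊓ φ, (isQF_literalFormula l).inf hφ, fun M _ v => ?_⟩
    rw [Formula.realize_inf, h]
    simp

theorem StablyInfinite.exists_infinite {T : L.Theory} (hT : StablyInfinite T) {Q : Instance L}
    {N : ℕ} {A : Assignment} (h : Compatible T Q N A) :
    ∃ (M : Type) (_ : L.Structure M) (v : ℕ → M), Infinite M ∧ M ⊨ T ∧ Agrees Q N A v := by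
  obtain ⟨φ, hφ, hr⟩ := exists_qf_conjunction (Q.literals N A)
  obtain ⟨M, _, v, hM, hv⟩ := h
  obtain ⟨M', _, v', hinf, hM', hv'⟩ := hT φ hφ ⟨M, _, v, hM, by
    rintro _ rfl
    exact (hr M v).2 ((Q.realize_literals_iff N A v).2 hv)⟩
  exact ⟨M', _, v', hinf, hM', (Q.realize_literals_iff N A v').1 ((hr M' v').1 hv')⟩

end Literals

/-! ### Bounds on the variables that occur -/

section Bounds

/-- A strict bound on the variables of a linear expression. -/
def LinExpr.varBound (e : LinExpr) : ℕ := (e.map fun p => p.2 + 1).sum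

theorem lt_sum_of_mem {α : Type*} (f : α → ℕ) {l : List α} {x : α} (hx : x ∈ l) {n : ℕ}
    (h : n < f x) : n < (l.map f).sum :=
  h.trans_le (List.single_le_sum (fun _ _ => Nat.zero_le _) _ (List.mem_map_of_mem hx))

theorem LinExpr.eval_congr (e : LinExpr) {A B : Assignment}
    (h : ∀ i < e.varBound, A i = B i) : e.eval A = e.eval B := by
  unfold LinExpr.eval
  congr 1
  exact List.map_congr_left fun p hp => by rw [h _ (lt_sum_of_mem _ hp (Nat.lt_succ_self _))]

variable {L : FirstOrder.Language.{0, 0}}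

/-- A strict bound on the variables in the code of a term. -/
def termVarBound (t : TermCode L) : ℕ := (t.map (Sum.elim Nat.succ fun _ => 0)).sum

/-- A strict bound on the variables in the code of an interface atom. -/
def interfaceVarBound (p : AtomCode L × Option ℕ) : ℕ :=
  (p.1.2.map termVarBound).sum + p.2.elim 0 Nat.succ

/-- A strict bound on the variables in the code of an instance. -/
def instanceVarBound (q : InstanceCode L) : ℕ :=
  (q.1.map fun c => LinExpr.varBound c.1).sum + (q.2.1.map interfaceVarBound).sum +
    LinExpr.varBound q.2.2

/-- All variables of the interface atoms are smaller than `N`. -/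
def Instance.InterfaceBelow (Q : Instance L) (N : ℕ) : Prop :=
  (∀ a ∈ Q.interface, ∀ t ∈ a.atom.code.2, ∀ i, Sum.inl i ∈ t → i < N) ∧
    ∀ a ∈ Q.interface, ∀ x, a.ann = some x → x < N

theorem Instance.interfaceBelow_varBound (Q : Instance L) :
    Q.InterfaceBelow (instanceVarBound Q.code) := by
  have key : ∀ a ∈ Q.interface, ∀ n, n < interfaceVarBound (a.atom.code, a.ann) →
      n < instanceVarBound Q.code := by
    intro a ha n hn
    have h := lt_sum_of_mem (l := Q.code.2.1) interfaceVarBound (x := (a.atom.code, a.ann))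
      (List.mem_map.2 ⟨a, ha, rfl⟩) hn
    unfold instanceVarBound
    omega
  refine ⟨fun a ha t ht i hi => key a ha i ?_, fun a ha x hx => key a ha x ?_⟩
  · have h1 : i < termVarBound t := lt_sum_of_mem _ hi (Nat.lt_succ_self i)
    exact (lt_sum_of_mem termVarBound ht h1).trans_le (Nat.le_add_right _ _)
  · simp only [interfaceVarBound, hx, Option.elim]
    omega

theorem Instance.constraint_varBound_le (Q : Instance L) {c : Constraint}
    (hc : c ∈ Q.constraints) : LinExpr.varBound c.1 ≤ instanceVarBound Q.code := by
  have : LinExpr.varBound c.1 ≤ (Q.constraints.map fun c => LinExpr.varBound c.1).sum :=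
    List.single_le_sum (fun _ _ => Nat.zero_le _) _ (List.mem_map_of_mem hc)
  unfold instanceVarBound
  change _ ≤ (Q.constraints.map fun c => LinExpr.varBound c.1).sum + _ + _
  omega

theorem Instance.objective_varBound_le (Q : Instance L) :
    LinExpr.varBound Q.objective ≤ instanceVarBound Q.code := Nat.le_add_left _ _

theorem Compatible.congr {T : L.Theory} {Q : Instance L} {N : ℕ} (hQ : Q.InterfaceBelow N)
    {A B : Assignment} (hE : ∀ i < N, ∀ j < N, A i = A j ↔ B i = B j)
    (hS : ∀ i < N, 0 < A i ↔ 0 < B i) (h : Compatible T Q N A) : Compatible T Q N B := by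
  obtain ⟨M, _, v, hM, hv⟩ := h
  refine ⟨M, _, v, hM, fun a ha => ?_, fun i hi j hj => ?_⟩
  · rw [hv.1 a ha]
    exact forall₂_congr fun x hx => hS x (hQ.2 a ha x hx)
  · rw [hv.2 i hi j hj, hE i hi j hj]

theorem isTModel_iff [Countable (Σ n, L.Functions n)] [Countable (Σ n, L.Relations n)]
    {T : L.Theory} (hT : StablyInfinite T) (Q : Instance L) {N : ℕ} (hQ : Q.InterfaceBelow N)
    (p : Subproblem) (A : Assignment) : IsTModel T Q p A ↔ p.Sat A ∧ Compatible T Q N A := by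
  refine and_congr_right fun _ => ⟨exists_agrees_of_satisfiable T Q N A, fun h => ?_⟩
  obtain ⟨M, _, v, _, hM, hv⟩ := hT.exists_infinite h
  exact satisfiable_of_agrees T Q N hQ.1 A hM v hv

end Bounds

/-! ### Small `T`-models -/

section SmallModels

/-- Constraints that fix the order and the signs of the first `N` variables as under `A`. -/
def arrangement (N : ℕ) (A : Assignment) : List Constraint :=
  ((List.range N).flatMap fun i => (List.range N).map fun j =>
    ([(1, i), (-1, j)], if A i ≤ A j then .le else .gt, 0)) ++
  (List.range N).map fun i => ([(1, i)], if 0 < A i then .gt else .le, 0)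

theorem length_arrangement (N : ℕ) (A : Assignment) :
    (arrangement N A).length = N * N + N := by
  simp [arrangement, List.length_flatMap]

theorem weight_arrangement_le {N : ℕ} {A : Assignment} {c : Constraint}
    (hc : c ∈ arrangement N A) : c.weight ≤ 3 := by
  simp only [arrangement, List.mem_append, List.mem_flatMap, List.mem_map] at hc
  rcases hc with ⟨i, _, j, _, rfl⟩ | ⟨i, _, rfl⟩ <;>
    simp [Constraint.weight, LinExpr.weight]

theorem sat_arrangement_iff (N : ℕ) (A B : Assignment) :
    (∀ c ∈ arrangement N A, c.Sat B) ↔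
      (∀ i < N, ∀ j < N, A i ≤ A j ↔ B i ≤ B j) ∧ ∀ i < N, 0 < A i ↔ 0 < B i := by
  simp only [arrangement, List.mem_append, or_imp, forall_and]
  refine and_congr ?_ ?_
  · simp only [List.mem_flatMap, List.mem_map, List.mem_range, forall_exists_index, and_imp]
    constructor
    · intro h i hi j hj
      have := h _ i hi j hj rfl
      by_cases hA : A i ≤ A j <;>
        simp [hA, Constraint.Sat, Rel.Holds, LinExpr.eval] at this ⊢ <;> omega
    · rintro h _ i hi j hj rfl
      have := h i hi j hj
      by_cases hA : A i ≤ A j <;>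
        simp [hA, Constraint.Sat, Rel.Holds, LinExpr.eval] at this ⊢ <;> omega
  · simp only [List.mem_map, List.mem_range, forall_exists_index, and_imp,
      forall_apply_eq_imp_iff₂]
    refine forall₂_congr fun i _ => ?_
    by_cases hA : 0 < A i <;> simp [hA, Constraint.Sat, Rel.Holds, LinExpr.eval]

/-- A bound on the values of small `T`-models of the given constraints. The `N * N + N` constraints
of an arrangement, whose weights are at most `3`, are taken into account, but the bound does not
depend on the arrangement. -/
def solutionBound (Cs : List Constraint) (N : ℕ) : ℕ :=
  genBound ((Cs.map Constraint.weight).sum + 3) (2 * (Cs.length + (N * N + N)) + 1)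

variable {L : FirstOrder.Language.{0, 0}} {T : L.Theory} {Q : Instance L} {N : ℕ}

/-- A `T`-model is the sum of a small `T`-model and of directions that lead to further
`T`-models: within an arrangement, all solutions of the constraints are `T`-models. -/
theorem Compatible.exists_small_add_directions (hQ : Q.InterfaceBelow N) (Cs : List Constraint)
    (hCs : ∀ c ∈ Cs, LinExpr.varBound c.1 ≤ N) (A : Assignment) (hA : ∀ c ∈ Cs, c.Sat A)
    (hcomp : Compatible T Q N A) :
    ∃ (g : Assignment) (G : Multiset Assignment), (∀ i < N, A i = (g + G.sum) i) ∧
      (∀ i, N ≤ i → g i = 0) ∧ (∀ i, (g i).natAbs ≤ solutionBound Cs N) ∧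
      ∀ G' : Multiset Assignment, (∀ h ∈ G', h ∈ G) →
        (∀ c ∈ Cs, c.Sat (g + G'.sum)) ∧ Compatible T Q N (g + G'.sum) := by
  let A' : Assignment := fun i => if i < N then A i else 0
  have hAA' : ∀ i < N, A i = A' i := fun i hi => by simp [A', hi]
  obtain ⟨g, G, hgG, hg0, hgB, hG⟩ := exists_small_solution_add_directions
    (Cs ++ arrangement N A') N (a := (Cs.map Constraint.weight).sum + 3)
    (m := 2 * (Cs.length + (N * N + N)) + 1) (by omega)
    (by rw [List.length_append, length_arrangement])
    (by
      intro c hc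
      rcases List.mem_append.1 hc with hc | hc
      · have : c.weight ≤ (Cs.map Constraint.weight).sum :=
          List.single_le_sum (fun _ _ => Nat.zero_le _) _ (List.mem_map_of_mem hc)
        omega
      · have := weight_arrangement_le hc
        omega)
    A' (fun i hi => by simp [A', not_lt.2 hi])
    (by
      intro c hc
      rcases List.mem_append.1 hc with hc | hc
      · have h := hA c hc
        unfold Constraint.Sat at h ⊢
        rwa [← LinExpr.eval_congr c.1 fun i hi => hAA' i (hi.trans_le (hCs c hc))]
      · exact (sat_arrangement_iff N A' A').2 ⟨fun _ _ _ _ => Iff.rfl, fun _ _ => Iff.rfl⟩ c hc)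
  refine ⟨g, G, fun i hi => by rw [hAA' i hi, hgG], hg0, hgB, fun G' hG' => ⟨fun c hc =>
    hG G' hG' c (List.mem_append_left _ hc), ?_⟩⟩
  obtain ⟨hle, hpos⟩ := (sat_arrangement_iff N A' _).1 fun c hc =>
    hG G' hG' c (List.mem_append_right _ hc)
  refine hcomp.congr hQ (fun i hi j hj => ?_) (fun i hi => ?_)
  · rw [hAA' i hi, hAA' j hj, le_antisymm_iff, le_antisymm_iff, hle i hi j hj, hle j hj i hi]
  · rw [hAA' i hi, hpos i hi]

/-- The assignment that a list stands for: its values on the first variables, and then `0`. -/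
def listAssignment (l : List ℤ) : Assignment := fun v => l.getD v 0

/-- All lists of `n` integers with absolute value at most `B`. -/
def box (B n : ℕ) : List (List ℤ) :=
  n.rec [ [] ] fun _ ls =>
    ls.flatMap fun l => (List.range (2 * B + 1)).map fun i : ℕ => ((i : ℤ) - (B : ℤ)) :: l

theorem mem_box (B : ℕ) (l : List ℤ) (hl : ∀ x ∈ l, x.natAbs ≤ B) : l ∈ box B l.length := by
  induction l with
  | nil => exact List.mem_singleton.2 rfl
  | cons x l ih =>
    have hx := hl x (by simp)
    change x :: l ∈ (box B l.length).flatMap fun l =>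
      (List.range (2 * B + 1)).map fun i : ℕ => ((i : ℤ) - (B : ℤ)) :: l
    have hlt : (x + (B : ℤ)).toNat < 2 * B + 1 := by omega
    have heq : (((x + (B : ℤ)).toNat : ℕ) : ℤ) - B = x := by omega
    exact List.mem_flatMap.2 ⟨l, ih fun y hy => hl y (by simp [hy]), List.mem_map.2
      ⟨_, List.mem_range.2 hlt, by rw [heq]⟩⟩

theorem Compatible.exists_mem_box (hQ : Q.InterfaceBelow N) (Cs : List Constraint)
    (hCs : ∀ c ∈ Cs, LinExpr.varBound c.1 ≤ N) (A : Assignment) (hA : ∀ c ∈ Cs, c.Sat A)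
    (hcomp : Compatible T Q N A) : ∃ l ∈ box (solutionBound Cs N) N,
      (∀ c ∈ Cs, c.Sat (listAssignment l)) ∧ Compatible T Q N (listAssignment l) := by
  obtain ⟨g, G, -, hg0, hgB, hG⟩ := hcomp.exists_small_add_directions hQ Cs hCs A hA
  have hl : listAssignment ((List.range N).map g) = g := by
    funext i
    by_cases hi : i < N
    · simp [listAssignment, hi]
    · simp [listAssignment, hi, hg0 i (not_lt.1 hi)]
  refine ⟨(List.range N).map g, ?_, ?_⟩
  · have := mem_box (solutionBound Cs N) ((List.range N).map g) (by
      intro x hx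
      obtain ⟨i, _, rfl⟩ := List.mem_map.1 hx
      exact hgB i)
    simpa using this
  · rw [hl]
    simpa using hG 0 (by simp)

/-- A `T`-model whose objective value is below the values of all small `T`-models has a
decreasing direction. -/
theorem Compatible.unbounded (hQ : Q.InterfaceBelow N) (Cs : List Constraint)
    (hCs : ∀ c ∈ Cs, LinExpr.varBound c.1 ≤ N) (O : LinExpr) (hO : O.varBound ≤ N)
    (A : Assignment) (hA : ∀ c ∈ Cs, c.Sat A) (hcomp : Compatible T Q N A)
    (hlow : O.eval A < -((O.weight * solutionBound Cs N : ℕ) : ℤ)) (k : ℤ) :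
    ∃ B : Assignment, (∀ c ∈ Cs, c.Sat B) ∧ Compatible T Q N B ∧ O.eval B < k := by
  obtain ⟨g, G, hAg, -, hgB, hG⟩ := hcomp.exists_small_add_directions hQ Cs hCs A hA
  have hgO := O.abs_eval_le g _ hgB
  rw [O.eval_congr fun i hi => hAg i (hi.trans_le hO), O.eval_add, O.eval_sum] at hlow
  obtain ⟨h, hhG, hh⟩ : ∃ h ∈ G, O.eval h < 0 := by
    by_contra! hc
    have : 0 ≤ (G.map O.eval).sum := Multiset.sum_nonneg (by simpa using hc)
    rw [abs_le] at hgO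
    push_cast at hlow
    omega
  let n := (O.eval g - k).toNat + 1
  obtain ⟨h1, h2⟩ := hG (Multiset.replicate n h) fun x hx => by
    rwa [Multiset.eq_of_mem_replicate hx]
  refine ⟨_, h1, h2, ?_⟩
  rw [O.eval_add, O.eval_sum, Multiset.map_replicate, Multiset.sum_replicate, nsmul_eq_mul]
  have h3 : (n : ℤ) * O.eval h ≤ n * (-1) :=
    mul_le_mul_of_nonneg_left (by omega) (by positivity)
  have h4 : (n : ℤ) = ((O.eval g - k).toNat : ℤ) + 1 := by simp [n]
  omega

end SmallModels

open Encodable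

/-! ### Primitive recursive integer arithmetic -/

section IntPrimrec

theorem encode_natCast (n : ℕ) : encode (n : ℤ) = 2 * n := rfl

theorem encode_negSucc (n : ℕ) : encode (Int.negSucc n) = 2 * n + 1 := rfl

theorem primrec_natCast : Primrec fun n : ℕ => (n : ℤ) :=
  Primrec.encode_iff.1 (Primrec.nat_double.of_eq fun n => (encode_natCast n).symm)

theorem primrec_negSucc : Primrec Int.negSucc :=
  Primrec.encode_iff.1 (Primrec.nat_double_succ.of_eq fun n => (encode_negSucc n).symm)

theorem primrec_toNat : Primrec Int.toNat := by
  refine (Primrec.cond (Primrec.nat_bodd.comp Primrec.encode) (Primrec.const 0)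
    (Primrec.nat_div2.comp Primrec.encode)).of_eq fun z => ?_
  cases z with
  | ofNat n => simp [encode_natCast, Nat.div2_val]
  | negSucc n => simp [encode_negSucc]

theorem primrec_toNat_neg : Primrec fun z : ℤ => (-z).toNat := by
  refine (Primrec.cond (Primrec.nat_bodd.comp Primrec.encode)
    (Primrec.succ.comp (Primrec.nat_div2.comp Primrec.encode)) (Primrec.const 0)).of_eq fun z => ?_
  cases z with
  | ofNat n => simp [encode_natCast]
  | negSucc n => simp [encode_negSucc, Nat.div2_val]

theorem primrec_natAbs : Primrec Int.natAbs :=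
  (Primrec.nat_add.comp primrec_toNat primrec_toNat_neg).of_eq fun z => by omega

theorem primrec_subNatNat : Primrec₂ Int.subNatNat := by
  refine (Primrec.ite (Primrec.nat_lt.comp Primrec.fst Primrec.snd)
    (primrec_negSucc.comp (Primrec.pred.comp (Primrec.nat_sub.comp Primrec.snd Primrec.fst)))
    (primrec_natCast.comp (Primrec.nat_sub.comp Primrec.fst Primrec.snd))).of_eq fun p => ?_
  obtain ⟨m, n⟩ := p
  rw [Int.subNatNat_eq_coe]
  dsimp only
  split_ifs with h
  · rw [Int.negSucc_eq]; simp only [Nat.pred_eq_sub_one]; omega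
  · omega

/-- An operation on integers is primitive recursive if it is a difference of primitive recursive
natural numbers. -/
theorem primrec_of_eq_sub {α : Type*} [Primcodable α] {f : α → ℤ} {g h : α → ℕ} (hg : Primrec g)
    (hh : Primrec h) (H : ∀ a, f a = g a - h a) : Primrec f :=
  (primrec_subNatNat.comp hg hh).of_eq fun a => by rw [H, Int.subNatNat_eq_coe]

variable {α : Type*} [Primcodable α] {f g : α → ℤ}

theorem primrec_int_neg (hf : Primrec f) : Primrec fun a => -f a :=
  primrec_of_eq_sub (primrec_toNat_neg.comp hf) (primrec_toNat.comp hf) fun a => by omega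

theorem primrec_int_add (hf : Primrec f) (hg : Primrec g) : Primrec fun a => f a + g a :=
  primrec_of_eq_sub
    (Primrec.nat_add.comp (primrec_toNat.comp hf) (primrec_toNat.comp hg))
    (Primrec.nat_add.comp (primrec_toNat_neg.comp hf) (primrec_toNat_neg.comp hg))
    fun a => by omega

theorem primrec_int_sub (hf : Primrec f) (hg : Primrec g) : Primrec fun a => f a - g a :=
  primrec_int_add hf (primrec_int_neg hg)

theorem primrec_int_mul (hf : Primrec f) (hg : Primrec g) : Primrec fun a => f a * g a := by
  have hf1 := primrec_toNat.comp hf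
  have hf2 := primrec_toNat_neg.comp hf
  have hg1 := primrec_toNat.comp hg
  have hg2 := primrec_toNat_neg.comp hg
  refine primrec_of_eq_sub
    (Primrec.nat_add.comp (Primrec.nat_mul.comp hf1 hg1) (Primrec.nat_mul.comp hf2 hg2))
    (Primrec.nat_add.comp (Primrec.nat_mul.comp hf1 hg2) (Primrec.nat_mul.comp hf2 hg1))
    fun a => ?_
  have h : ∀ z : ℤ, z = (z.toNat : ℤ) - ((-z).toNat : ℤ) := fun z => by omega
  conv_lhs => rw [h (f a), h (g a)]
  push_cast
  ring

theorem primrecPred_int_le (hf : Primrec f) (hg : Primrec g) : PrimrecPred fun a => f a ≤ g a := by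
  refine (PrimrecRel.comp Primrec.nat_le (primrec_toNat.comp (primrec_int_sub hf hg))
    (Primrec.const 0)).of_eq fun a => ?_
  omega

theorem primrecPred_int_lt (hf : Primrec f) (hg : Primrec g) : PrimrecPred fun a => f a < g a :=
  (primrecPred_int_le hg hf).not.of_eq fun _ => not_le

end IntPrimrec

section ListPrimrec

variable {α β : Type*} [Primcodable α] [Primcodable β]

theorem primrec_list_sum_nat {f : α → List β} {g : α → β → ℕ} (hf : Primrec f) (hg : Primrec₂ g) :
    Primrec fun a => ((f a).map (g a)).sum := by
  refine (Primrec.list_foldr (h := fun a p => g a p.1 + p.2) hf (Primrec.const 0)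
    (Primrec.nat_add.comp (hg.comp Primrec.fst (Primrec.fst.comp Primrec.snd))
      (Primrec.snd.comp Primrec.snd)).to₂).of_eq fun a => ?_
  induction f a with
  | nil => rfl
  | cons x l ih => simp only [List.foldr_cons, List.map_cons, List.sum_cons, ih]

theorem primrec_list_sum_int {f : α → List β} {g : α → β → ℤ} (hf : Primrec f) (hg : Primrec₂ g) :
    Primrec fun a => ((f a).map (g a)).sum := by
  refine (Primrec.list_foldr (h := fun a p => g a p.1 + p.2) hf (Primrec.const 0)
    (primrec_int_add (hg.comp Primrec.fst (Primrec.fst.comp Primrec.snd))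
      (Primrec.snd.comp Primrec.snd)).to₂).of_eq fun a => ?_
  induction f a with
  | nil => rfl
  | cons x l ih => simp only [List.foldr_cons, List.map_cons, List.sum_cons, ih]

theorem computable_list_any {f : α → List β} {p : α → β → Bool} (hf : Computable f)
    (hp : Computable₂ p) : Computable fun a => (f a).any (p a) := by
  have hstep : Computable₂ fun (a : α) (q : ℕ × Bool) =>
      cond q.2 true (Option.casesOn ((f a)[q.1]?) false (p a) : Bool) := by
    refine Computable.cond (Computable.snd.comp Computable.snd) (Computable.const true) ?_
    refine Computable.option_casesOn (Computable.list_getElem?.comp (hf.comp Computable.fst)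
      (Computable.fst.comp Computable.snd)) (Computable.const false) ?_
    exact hp.comp (Computable.fst.comp Computable.fst) Computable.snd
  refine (Computable.nat_rec (Computable.list_length.comp hf) (Computable.const false)
    hstep).of_eq fun a => ?_
  have h : ∀ n ≤ (f a).length, (Nat.rec false (fun n b =>
      cond b true (Option.casesOn ((f a)[n]?) false (p a) : Bool)) n : Bool) =
      ((f a).take n).any (p a) := by
    intro n
    induction n with
    | zero => intro _; simp
    | succ n ih =>
      intro hn
      have hget : (f a)[n]? = some (f a)[n] := List.getElem?_eq_getElem hn
      rw [List.take_add_one, List.any_append, ← ih (by omega)]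
      simp [hget]
  rw [h _ le_rfl, List.take_length]

end ListPrimrec

/-! ### The algorithm -/

section Algorithm

variable {L : FirstOrder.Language.{0, 0}}

/-- A constraint without solutions. It does not belong to `Cs`, since the weight of a constraint
exceeds the absolute value of its right-hand side. -/
def freshFalsum (Cs : List Constraint) : Constraint :=
  ([], .lt, -((Cs.map Constraint.weight).sum : ℤ))

/-- The code of the starting state. -/
def startCode (Cs : List Constraint) : StateCode := ([(Cs, [])], none)

/-- The run for an instance without `T`-models: a contradiction is learned. -/
def refutationRun (Cs : List Constraint) : List StateCode :=
  [startCode Cs, ([(freshFalsum Cs :: Cs, [])], none), ([], none)]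

/-- The run that finishes the root subproblem at once with a `T`-model. The Boolean is the
annotation `-∞`. -/
def modelRun (Cs : List Constraint) (b : Bool) (l : List ℤ) : List StateCode :=
  [startCode Cs, ([], some (b, l))]

variable (d : List (Bool × AtomCode L) → Bool)

open Classical in
/-- The test whether the assignment with the given list of values satisfies the constraints and
is compatible with the interface atoms, where `d` decides conjunctions of literals. -/
noncomputable def isModel (N : ℕ) (I : List (AtomCode L × Option ℕ)) (Cs : List Constraint)
    (l : List ℤ) : Bool :=
  decide (∀ c ∈ Cs, c.Sat (listAssignment l)) && d (literals (varEqCode L) N (listAssignment l) I)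

/-- The test whether there is a small `T`-model. -/
noncomputable def feasible (N : ℕ) (I : List (AtomCode L × Option ℕ)) (Cs : List Constraint) :
    Bool :=
  (box (solutionBound Cs N) N).any (isModel d N I Cs)

/-- The test whether the assignment has an objective value below those of all small
`T`-models. -/
def isLow (N : ℕ) (Cs : List Constraint) (O : LinExpr) (l : List ℤ) : Bool :=
  decide (O.eval (listAssignment l) < -((O.weight * solutionBound Cs N : ℕ) : ℤ))

/-- The constraints, and a lower objective value than that of the given assignment. -/
def improvement (Cs : List Constraint) (O : LinExpr) (l : List ℤ) : List Constraint :=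
  (O, .lt, O.eval (listAssignment l)) :: Cs

/-- A list of values is accepted if it is a `T`-model that is lower than all small ones, or that
has no `T`-model below. -/
noncomputable def acceptModel (q : InstanceCode L) (l : List ℤ) : Option (List StateCode) :=
  bif isModel d (instanceVarBound q) q.2.1 q.1 l then
    bif isLow (instanceVarBound q) q.1 q.2.2 l then some (modelRun q.1 true l)
    else bif feasible d (instanceVarBound q) q.2.1 (improvement q.1 q.2.2 l) then none
    else some (modelRun q.1 false l)
  else none

/-- Step `n` of the search: if there is a `T`-model, then `n` is decoded as a list of values. -/
noncomputable def searchStep (q : InstanceCode L) (n : ℕ) : Option (List StateCode) :=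
  bif feasible d (instanceVarBound q) q.2.1 q.1 then
    (decode n : Option (List ℤ)).bind (acceptModel d q)
  else some (refutationRun q.1)

end Algorithm

/-! ### Computability of the algorithm -/

section Computability

variable {L : FirstOrder.Language.{0, 0}}
variable [Primcodable (Σ n, L.Functions n)] [Primcodable (Σ n, L.Relations n)]

theorem primrec_listAssignment : Primrec₂ fun (l : List ℤ) (i : ℕ) => listAssignment l i :=
  Primrec.list_getD 0

theorem primrec_eval :
    Primrec₂ fun (e : LinExpr) (l : List ℤ) => LinExpr.eval e (listAssignment l) :=
  primrec_list_sum_int (f := fun p : LinExpr × List ℤ => p.1)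
    (g := fun p t => t.1 * listAssignment p.2 t.2) Primrec.fst
    (primrec_int_mul (Primrec.fst.comp Primrec.snd)
      (primrec_listAssignment.comp (Primrec.snd.comp Primrec.fst)
        (Primrec.snd.comp Primrec.snd))).to₂

theorem primrecRel_sat :
    PrimrecRel fun (c : Constraint) (l : List ℤ) => c.Sat (listAssignment l) := by
  have he : Primrec fun p : Constraint × List ℤ => LinExpr.eval p.1.1 (listAssignment p.2) :=
    primrec_eval.comp (Primrec.fst.comp Primrec.fst) Primrec.snd
  have hr : Primrec fun p : Constraint × List ℤ => p.1.2.2 :=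
    Primrec.snd.comp (Primrec.snd.comp Primrec.fst)
  have hR : ∀ R : Rel, PrimrecPred fun p : Constraint × List ℤ => p.1.2.1 = R := fun R =>
    PrimrecRel.comp Primrec.eq (Primrec.fst.comp (Primrec.snd.comp Primrec.fst))
      (Primrec.const R)
  have hle := primrecPred_int_le he hr
  have hge := primrecPred_int_le hr he
  refine PrimrecPred.of_eq
    ((((hR .lt).and hge.not).or ((hR .le).and hle)).or (((hR .eq).and (hle.and hge)).or
      (((hR .gt).and hle.not).or ((hR .ge).and hge)))) fun p => ?_
  obtain ⟨⟨e, R, r⟩, l⟩ := p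
  cases R <;> simp [Constraint.Sat, Rel.Holds, le_antisymm_iff]

theorem primrecRel_sat_all :
    PrimrecRel fun (Cs : List Constraint) (l : List ℤ) => ∀ c ∈ Cs, c.Sat (listAssignment l) :=
  primrecRel_sat.forall_mem_list

theorem primrec_linExpr_weight : Primrec LinExpr.weight :=
  primrec_list_sum_nat (g := fun _ (p : ℤ × ℕ) => p.1.natAbs) Primrec.id
    (primrec_natAbs.comp (Primrec.fst.comp Primrec.snd)).to₂

theorem primrec_constraint_weight : Primrec Constraint.weight :=
  Primrec.succ.comp (Primrec.nat_add.comp (primrec_linExpr_weight.comp Primrec.fst)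
    (primrec_natAbs.comp (Primrec.snd.comp Primrec.snd)))

theorem primrec_weight_sum : Primrec fun Cs : List Constraint => (Cs.map Constraint.weight).sum :=
  primrec_list_sum_nat (g := fun _ (c : Constraint) => c.weight) Primrec.id
    (primrec_constraint_weight.comp Primrec.snd).to₂

theorem primrec_genBound : Primrec₂ genBound := by
  refine Primrec.nat_rec (f := fun _ : ℕ => 1) (g := fun a p => (2 * (a * p.2) + 1) * p.2)
    (Primrec.const 1) ?_
  have hB : Primrec fun p : ℕ × ℕ × ℕ => p.2.2 := Primrec.snd.comp Primrec.snd
  exact (Primrec.nat_mul.comp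
    (Primrec.nat_double_succ.comp (Primrec.nat_mul.comp Primrec.fst hB)) hB).to₂

theorem primrec_solutionBound : Primrec₂ solutionBound := by
  have hN : Primrec fun p : List Constraint × ℕ => p.2 := Primrec.snd
  exact primrec_genBound.comp
    (Primrec.nat_add.comp (primrec_weight_sum.comp Primrec.fst) (Primrec.const 3))
    (Primrec.nat_double_succ.comp (Primrec.nat_add.comp (Primrec.list_length.comp Primrec.fst)
      (Primrec.nat_add.comp (Primrec.nat_mul.comp hN hN) hN)))

theorem primrec_box : Primrec₂ box := by
  refine Primrec.nat_rec (f := fun _ : ℕ => [ ([] : List ℤ) ])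
    (g := fun B p => p.2.flatMap fun l =>
      (List.range (2 * B + 1)).map fun i : ℕ => ((i : ℤ) - (B : ℤ)) :: l)
    (Primrec.const _) ?_
  refine Primrec.list_flatMap (Primrec.snd.comp Primrec.snd) ?_
  refine Primrec.list_map
    (Primrec.list_range.comp (Primrec.nat_double_succ.comp (Primrec.fst.comp Primrec.fst))) ?_
  exact Primrec.list_cons.comp
    (primrec_int_sub (primrec_natCast.comp Primrec.snd)
      (primrec_natCast.comp (Primrec.fst.comp (Primrec.fst.comp Primrec.fst))))
    (Primrec.snd.comp Primrec.fst)

theorem primrec_varEqCode : Primrec₂ (varEqCode L) := by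
  have h : ∀ {f : ℕ × ℕ → ℕ}, Primrec f →
      Primrec fun p => ([Sum.inl (f p)] : TermCode L) := fun hf =>
    Primrec.list_cons.comp (Primrec.sumInl.comp hf) (Primrec.const [])
  exact Primrec.pair (Primrec.const none) (Primrec.list_cons.comp (h Primrec.fst)
    (Primrec.list_cons.comp (h Primrec.snd) (Primrec.const [])))

theorem primrec_literals :
    Primrec fun p : (ℕ × List (AtomCode L × Option ℕ)) × List ℤ =>
      literals (varEqCode L) p.1.1 (listAssignment p.2) p.1.2 := by
  have hval : Primrec fun z : (((ℕ × List (AtomCode L × Option ℕ)) × List ℤ) × ℕ) × ℕ =>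
      listAssignment z.1.1.2 z.2 :=
    primrec_listAssignment.comp (Primrec.snd.comp (Primrec.fst.comp Primrec.fst)) Primrec.snd
  have hval' : Primrec fun z : (((ℕ × List (AtomCode L × Option ℕ)) × List ℤ) × ℕ) × ℕ =>
      listAssignment z.1.1.2 z.1.2 :=
    primrec_listAssignment.comp (Primrec.snd.comp (Primrec.fst.comp Primrec.fst))
      (Primrec.snd.comp Primrec.fst)
  have hsign : Primrec fun z :
      ((ℕ × List (AtomCode L × Option ℕ)) × List ℤ) × (AtomCode L × Option ℕ) =>
        z.2.2.elim true fun x => decide (0 < listAssignment z.1.2 x) := by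
    have h : PrimrecPred
        fun z : (((ℕ × List (AtomCode L × Option ℕ)) × List ℤ) × (AtomCode L × Option ℕ)) × ℕ =>
          0 < listAssignment z.1.1.2 z.2 :=
      primrecPred_int_lt (Primrec.const 0)
        (primrec_listAssignment.comp (Primrec.snd.comp (Primrec.fst.comp Primrec.fst)) Primrec.snd)
    refine (Primrec.option_casesOn (Primrec.snd.comp Primrec.snd) (Primrec.const true)
      (primrecPred_iff_primrec_decide.1 h).to₂).of_eq fun z => ?_
    cases z.2.2 <;> rfl
  have heq : Primrec fun z : (((ℕ × List (AtomCode L × Option ℕ)) × List ℤ) × ℕ) × ℕ =>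
      decide (listAssignment z.1.1.2 z.1.2 = listAssignment z.1.1.2 z.2) :=
    primrecPred_iff_primrec_decide.1 (PrimrecRel.comp Primrec.eq hval' hval)
  have hvar : Primrec fun z : (((ℕ × List (AtomCode L × Option ℕ)) × List ℤ) × ℕ) × ℕ =>
      varEqCode L z.1.2 z.2 :=
    primrec_varEqCode.comp (Primrec.snd.comp Primrec.fst) Primrec.snd
  have hrange : Primrec fun p : (ℕ × List (AtomCode L × Option ℕ)) × List ℤ =>
      List.range p.1.1 := Primrec.list_range.comp (Primrec.fst.comp Primrec.fst)
  have h1 : Primrec fun p : (ℕ × List (AtomCode L × Option ℕ)) × List ℤ =>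
      p.1.2.map fun x => (x.2.elim true fun v => decide (0 < listAssignment p.2 v), x.1) :=
    Primrec.list_map (Primrec.snd.comp Primrec.fst)
      (Primrec.pair hsign (Primrec.fst.comp Primrec.snd))
  have h2 : Primrec fun p : (ℕ × List (AtomCode L × Option ℕ)) × List ℤ =>
      (List.range p.1.1).flatMap fun i => (List.range p.1.1).map fun j =>
        (decide (listAssignment p.2 i = listAssignment p.2 j), varEqCode L i j) :=
    Primrec.list_flatMap hrange (Primrec.list_map (hrange.comp Primrec.fst)
      (Primrec.pair heq hvar))
  exact Primrec.list_append.comp h1 h2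

theorem primrec_varBound : Primrec LinExpr.varBound :=
  primrec_list_sum_nat (g := fun _ (p : ℤ × ℕ) => p.2 + 1) Primrec.id
    (Primrec.succ.comp (Primrec.snd.comp Primrec.snd)).to₂

theorem primrec_instanceVarBound : Primrec (instanceVarBound (L := L)) := by
  have hterm : Primrec (termVarBound (L := L)) := by
    refine primrec_list_sum_nat (g := fun _ => Sum.elim Nat.succ fun _ => 0) Primrec.id ?_
    refine (Primrec.sumCasesOn (g := fun _ n => Nat.succ n) (h := fun _ _ => 0) Primrec.snd
      (Primrec.succ.comp Primrec.snd).to₂ (Primrec.const 0).to₂).to₂.of_eq fun _ x => ?_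
    cases x <;> rfl
  have hint : Primrec (interfaceVarBound (L := L)) := by
    refine Primrec.nat_add.comp (primrec_list_sum_nat (g := fun _ t => termVarBound t)
      (Primrec.snd.comp Primrec.fst) (hterm.comp Primrec.snd).to₂) ?_
    refine (Primrec.option_casesOn (g := fun _ n => Nat.succ n) Primrec.snd (Primrec.const 0)
      (Primrec.succ.comp Primrec.snd).to₂).of_eq fun z => ?_
    cases z.2 <;> rfl
  refine Primrec.nat_add.comp (Primrec.nat_add.comp ?_ ?_)
    (primrec_varBound.comp (Primrec.snd.comp Primrec.snd))
  · exact primrec_list_sum_nat Primrec.fst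
      (primrec_varBound.comp (Primrec.fst.comp Primrec.snd)).to₂
  · exact primrec_list_sum_nat (Primrec.fst.comp Primrec.snd) (hint.comp Primrec.snd).to₂

variable {d : List (Bool × AtomCode L) → Bool}

section

variable {α : Type*} [Primcodable α] {N : α → ℕ} {I : α → List (AtomCode L × Option ℕ)}
  {Cs : α → List Constraint} {l : α → List ℤ}

theorem computable_isModel (hd : Computable d) (hN : Primrec N) (hI : Primrec I)
    (hCs : Primrec Cs) (hl : Primrec l) :
    Computable fun a => isModel d (N a) (I a) (Cs a) (l a) := by
  classical
  have h1 : Primrec fun a => decide (∀ c ∈ Cs a, c.Sat (listAssignment (l a))) :=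
    primrecPred_iff_primrec_decide.1 (PrimrecRel.comp primrecRel_sat_all hCs hl)
  have h2 : Primrec fun a => literals (varEqCode L) (N a) (listAssignment (l a)) (I a) :=
    primrec_literals.comp (Primrec.pair (Primrec.pair hN hI) hl)
  exact ((Primrec.dom_bool₂ and).to_comp.comp h1.to_comp (hd.comp h2.to_comp)).of_eq fun z => by
    simp [isModel]

theorem computable_feasible (hd : Computable d) (hN : Primrec N) (hI : Primrec I)
    (hCs : Primrec Cs) : Computable fun a => feasible d (N a) (I a) (Cs a) := by
  have hbox : Primrec fun a => box (solutionBound (Cs a) (N a)) (N a) :=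
    primrec_box.comp (primrec_solutionBound.comp hCs hN) hN
  have hmodel : Computable₂ fun a l => isModel d (N a) (I a) (Cs a) l :=
    computable_isModel hd (hN.comp Primrec.fst) (hI.comp Primrec.fst) (hCs.comp Primrec.fst)
      Primrec.snd
  exact computable_list_any hbox.to_comp hmodel

end

theorem primrec_startCode : Primrec startCode :=
  Primrec.pair (Primrec.list_cons.comp (Primrec.pair Primrec.id (Primrec.const []))
    (Primrec.const [])) (Primrec.const none)

theorem primrec_refutationRun : Primrec refutationRun := by
  have hf : Primrec freshFalsum := Primrec.pair (Primrec.const [])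
    (Primrec.pair (Primrec.const Rel.lt)
      (primrec_int_neg (primrec_natCast.comp primrec_weight_sum)))
  have h1 : Primrec fun Cs : List Constraint =>
      (([(freshFalsum Cs :: Cs, [])], none) : StateCode) :=
    Primrec.pair (Primrec.list_cons.comp (Primrec.pair (Primrec.list_cons.comp hf Primrec.id)
      (Primrec.const [])) (Primrec.const [])) (Primrec.const none)
  exact Primrec.list_cons.comp primrec_startCode
    (Primrec.list_cons.comp h1 (Primrec.const [([], none)]))

theorem primrec_modelRun (b : Bool) : Primrec₂ fun Cs => modelRun Cs b := by
  have h1 : Primrec fun p : List Constraint × List ℤ => (([], some (b, p.2)) : StateCode) :=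
    Primrec.pair (Primrec.const []) (Primrec.option_some.comp
      (Primrec.pair (Primrec.const b) Primrec.snd))
  exact Primrec.list_cons.comp (primrec_startCode.comp Primrec.fst)
    (Primrec.list_cons.comp h1 (Primrec.const []))

theorem computable_acceptModel (hd : Computable d) : Computable₂ (acceptModel d) := by
  have hCs : Primrec fun z : InstanceCode L × List ℤ => z.1.1 := Primrec.fst.comp Primrec.fst
  have hO : Primrec fun z : InstanceCode L × List ℤ => z.1.2.2 :=
    Primrec.snd.comp (Primrec.snd.comp Primrec.fst)
  have hN : Primrec fun z : InstanceCode L × List ℤ => instanceVarBound z.1 :=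
    primrec_instanceVarBound.comp Primrec.fst
  have hI : Primrec fun z : InstanceCode L × List ℤ => z.1.2.1 :=
    Primrec.fst.comp (Primrec.snd.comp Primrec.fst)
  have hl : Primrec fun z : InstanceCode L × List ℤ => z.2 := Primrec.snd
  have heval : Primrec fun z : InstanceCode L × List ℤ =>
      LinExpr.eval z.1.2.2 (listAssignment z.2) := primrec_eval.comp hO hl
  have hlow : Primrec fun z : InstanceCode L × List ℤ =>
      isLow (instanceVarBound z.1) z.1.1 z.1.2.2 z.2 := by
    have hw : Primrec fun z : InstanceCode L × List ℤ =>
        LinExpr.weight z.1.2.2 * solutionBound z.1.1 (instanceVarBound z.1) :=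
      Primrec.nat_mul.comp (primrec_linExpr_weight.comp hO) (primrec_solutionBound.comp hCs hN)
    exact primrecPred_iff_primrec_decide.1
      (primrecPred_int_lt heval (primrec_int_neg (primrec_natCast.comp hw)))
  have himp : Primrec fun z : InstanceCode L × List ℤ => improvement z.1.1 z.1.2.2 z.2 :=
    Primrec.list_cons.comp (Primrec.pair hO (Primrec.pair (Primrec.const Rel.lt) heval)) hCs
  have hmodel := computable_isModel hd hN hI hCs hl
  have hbelow := computable_feasible hd hN hI himp
  have hrun : ∀ b, Computable fun z : InstanceCode L × List ℤ => some (modelRun z.1.1 b z.2) :=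
    fun b => (Primrec.option_some.comp ((primrec_modelRun b).comp hCs hl)).to_comp
  have hnone : Computable fun _ : InstanceCode L × List ℤ => (none : Option (List StateCode)) :=
    Computable.const none
  have h1 := Computable.cond hbelow hnone (hrun false)
  have h2 := Computable.cond hlow.to_comp (hrun true) h1
  exact (Computable.cond hmodel h2 hnone).of_eq fun _ => rfl

theorem computable_searchStep (hd : Computable d) : Computable₂ (searchStep d) := by
  have hN : Primrec fun z : InstanceCode L × ℕ => instanceVarBound z.1 :=
    primrec_instanceVarBound.comp Primrec.fst
  have hI : Primrec fun z : InstanceCode L × ℕ => z.1.2.1 :=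
    Primrec.fst.comp (Primrec.snd.comp Primrec.fst)
  have hCs : Primrec fun z : InstanceCode L × ℕ => z.1.1 := Primrec.fst.comp Primrec.fst
  have hfeas := computable_feasible hd hN hI hCs
  have hdec : Computable fun z : InstanceCode L × ℕ => (decode z.2 : Option (List ℤ)) :=
    Computable.decode.comp Computable.snd
  have hacc : Computable₂ fun (z : InstanceCode L × ℕ) (l : List ℤ) => acceptModel d z.1 l :=
    (computable_acceptModel hd).comp (Computable.fst.comp Computable.fst) Computable.snd
  have href : Computable fun z : InstanceCode L × ℕ => some (refutationRun z.1.1) :=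
    (Primrec.option_some.comp (primrec_refutationRun.comp hCs)).to_comp
  exact (Computable.cond hfeas (Computable.option_bind hdec hacc) href).of_eq fun _ => rfl

end Computability

/-! ### Correctness of the runs -/

section Runs

variable {L : FirstOrder.Language.{0, 0}} {T : L.Theory} {Q : Instance L}
  {lb : Subproblem → EReal}

theorem toState_startCode (Q : Instance L) :
    (startCode Q.constraints).toState = Q.start := rfl

theorem toState_final_some (l : List ℤ) :
    StateCode.toState ([], some (false, l)) = ⟨∅, .some (listAssignment l)⟩ := rfl

theorem toState_final_negInf (l : List ℤ) :
    StateCode.toState ([], some (true, l)) = ⟨∅, .negInf (listAssignment l)⟩ := rfl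

theorem Instance.root_sat_iff (Q : Instance L) (A : Assignment) :
    Q.root.Sat A ↔ ∀ c ∈ Q.constraints, c.Sat A := by
  simp [Instance.root, Subproblem.Sat]

theorem freshFalsum_notMem (Cs : List Constraint) : freshFalsum Cs ∉ Cs := by
  intro h
  have h1 : (freshFalsum Cs).weight ≤ (Cs.map Constraint.weight).sum :=
    List.single_le_sum (fun _ _ => Nat.zero_le _) _ (List.mem_map_of_mem h)
  simp only [Constraint.weight, freshFalsum, Int.natAbs_neg, Int.natAbs_natCast] at h1
  omega

theorem not_sat_freshFalsum (Cs : List Constraint) (A : Assignment) :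
    ¬ (freshFalsum Cs).Sat A := by
  intro h
  have h' : (0 : ℤ) < -((Cs.map Constraint.weight).sum : ℕ) := h
  omega

theorem finite_root_formulas (Q : Instance L) : (Q.root.formulas L).Finite := by
  have h : Q.root.formulas L =
      (fun c => Constraint.toFormula L c) '' (Q.root.C : Set Constraint) := by
    ext φ
    simp [Subproblem.formulas, cFormulas, dFormulas, Instance.root, eq_comm]
  rw [h]
  exact Q.root.C.finite_toSet.image _

theorem isCompleteRun_refutationRun
    (h : ¬ Satisfiable (zTheory L ∪ tTheory T) (Q.root.formulas L ∪ Q.iFormulas))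
    (hno : ∀ B, ¬ IsTModel T Q Q.root B) :
    IsCompleteRun T Q lb ((refutationRun Q.constraints).map StateCode.toState) := by
  have h1 : Step T Q lb Q.start
      (StateCode.toState ([(freshFalsum Q.constraints :: Q.constraints, [])], none)) := by
    have := Step.tLearn (T := T) (Q := Q) (lb := lb) ∅ Q.root .none (freshFalsum Q.constraints)
      (by simp) (by simpa [Instance.root] using freshFalsum_notMem Q.constraints)
      (exists_interpolant_of_not_satisfiable _ _ (finite_root_formulas Q) _ h _)
    simpa [Instance.start, StateCode.toState, Instance.root] using this
  have h2 : Step T Q lb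
      (StateCode.toState ([(freshFalsum Q.constraints :: Q.constraints, [])], none))
      (StateCode.toState ([], none)) := by
    have := Step.drop (T := T) (Q := Q) (lb := lb) ∅
      ⟨(freshFalsum Q.constraints :: Q.constraints).toFinset, ∅⟩ .none (by simp)
      (fun B hB => not_sat_freshFalsum Q.constraints B (hB.1 _ (by simp)))
    simpa [StateCode.toState] using this
  refine ⟨rfl, ?_, .none, ?_, hno⟩
  · simp only [refutationRun, List.map_cons, List.map_nil, toState_startCode]
    exact .cons_cons h1 (.cons_cons h2 (.singleton _))
  · simp [refutationRun, StateCode.toState]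

theorem isCompleteRun_retire (l : List ℤ) (hl : IsTModel T Q Q.root (listAssignment l))
    (hopt : ∀ B, IsTModel T Q Q.root B →
      Q.objective.eval (listAssignment l) ≤ Q.objective.eval B) :
    IsCompleteRun T Q lb ((modelRun Q.constraints false l).map StateCode.toState) := by
  have h1 : Step T Q lb Q.start (StateCode.toState ([], some (false, l))) := by
    have := Step.retire (T := T) (Q := Q) (lb := lb) ∅ Q.root .none (listAssignment l) (by simp) hl
      (EReal.coe_lt_top _) hopt
    simpa [toState_final_some, Instance.start] using this
  refine ⟨rfl, ?_, .some (listAssignment l), ?_, hl, hopt⟩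
  · simp only [modelRun, List.map_cons, List.map_nil, toState_startCode]
    exact .cons_cons h1 (.singleton _)
  · simp [modelRun, toState_final_some]

theorem isCompleteRun_unbounded (l : List ℤ) (hl : IsTModel T Q Q.root (listAssignment l))
    (hunb : ∀ k : ℤ, ∃ B, IsTModel T Q Q.root B ∧ Q.objective.eval B < k) :
    IsCompleteRun T Q lb ((modelRun Q.constraints true l).map StateCode.toState) := by
  have h1 : Step T Q lb Q.start (StateCode.toState ([], some (true, l))) := by
    have := Step.unbounded (T := T) (Q := Q) (lb := lb) ∅ Q.root .none (listAssignment l)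
      (by simp) hl le_top hunb
    simpa [toState_final_negInf, Instance.start] using this
  refine ⟨rfl, ?_, .negInf (listAssignment l), ?_, hl, hunb⟩
  · simp only [modelRun, List.map_cons, List.map_nil, toState_startCode]
    exact .cons_cons h1 (.singleton _)
  · simp [modelRun, toState_final_negInf]

end Runs

/-! ### Correctness of the search -/

section Search

variable {L : FirstOrder.Language.{0, 0}} {T : L.Theory} {Q : Instance L}
  {d : List (Bool × AtomCode L) → Bool}

theorem isModel_iff
    (hd : ∀ Γ : List (Bool × Atom L), d (Γ.map fun l => (l.1, l.2.code)) = true ↔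
      Satisfiable T {φ | ∃ l ∈ Γ, φ = literalFormula l})
    (N : ℕ) (Cs : List Constraint) (l : List ℤ) :
    isModel d N Q.code.2.1 Cs l = true ↔
      (∀ c ∈ Cs, c.Sat (listAssignment l)) ∧ Compatible T Q N (listAssignment l) := by
  simp only [isModel, Bool.and_eq_true, decide_eq_true_eq]
  rw [← Instance.literals_code, hd, satisfiable_literals_iff]

theorem feasible_iff
    (hd : ∀ Γ : List (Bool × Atom L), d (Γ.map fun l => (l.1, l.2.code)) = true ↔
      Satisfiable T {φ | ∃ l ∈ Γ, φ = literalFormula l})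
    {N : ℕ} (hQ : Q.InterfaceBelow N) (Cs : List Constraint)
    (hCs : ∀ c ∈ Cs, LinExpr.varBound c.1 ≤ N) :
    feasible d N Q.code.2.1 Cs = true ↔
      ∃ A : Assignment, (∀ c ∈ Cs, c.Sat A) ∧ Compatible T Q N A := by
  rw [feasible, List.any_eq_true]
  simp only [isModel_iff hd]
  constructor
  · rintro ⟨l, _, h⟩
    exact ⟨_, h⟩
  · rintro ⟨A, hA, hcomp⟩
    exact hcomp.exists_mem_box hQ Cs hCs A hA

/-- The search succeeds: if the objective values of the `T`-models are bounded below, then a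
`T`-model of least value is accepted. -/
theorem exists_mem_searchStep
    (hd : ∀ Γ : List (Bool × Atom L), d (Γ.map fun l => (l.1, l.2.code)) = true ↔
      Satisfiable T {φ | ∃ l ∈ Γ, φ = literalFormula l}) (Q : Instance L) :
    ∃ n run, searchStep d Q.code n = some run := by
  have hQ := Q.interfaceBelow_varBound
  have hCs : ∀ c ∈ Q.constraints, LinExpr.varBound c.1 ≤ instanceVarBound Q.code :=
    fun c hc => Q.constraint_varBound_le hc
  cases hF : feasible d (instanceVarBound Q.code) Q.code.2.1 Q.code.1 with
  | false => exact ⟨0, refutationRun Q.code.1, by rw [searchStep, hF, cond_false]⟩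
  | true =>
    suffices h : ∃ l run, acceptModel d Q.code l = some run by
      obtain ⟨l, run, h⟩ := h
      refine ⟨encode l, run, ?_⟩
      rw [searchStep, hF, cond_true, encodek]
      exact h
    let P : List ℤ → Prop := fun l =>
      isModel d (instanceVarBound Q.code) Q.code.2.1 Q.code.1 l = true
    by_cases hlow : ∃ l, P l ∧ isLow (instanceVarBound Q.code) Q.code.1 Q.code.2.2 l = true
    · obtain ⟨l, hl, hlow⟩ := hlow
      exact ⟨l, _, by rw [acceptModel, hl, cond_true, hlow, cond_true]⟩
    push Not at hlow
    obtain ⟨l₀, -, hl₀⟩ := List.any_eq_true.1 hF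
    obtain ⟨z, ⟨l, hl, rfl⟩, hmin⟩ := Int.exists_least_of_bdd
      (P := fun z => ∃ l, P l ∧ LinExpr.eval Q.code.2.2 (listAssignment l) = z)
      ⟨-((LinExpr.weight Q.code.2.2 *
        solutionBound Q.code.1 (instanceVarBound Q.code) : ℕ) : ℤ), by
          rintro z ⟨l, hl, rfl⟩
          by_contra! hc
          exact hlow l hl (decide_eq_true hc)⟩
      ⟨_, l₀, hl₀, rfl⟩
    refine ⟨l, modelRun Q.code.1 false l, ?_⟩
    have hbelow : feasible d (instanceVarBound Q.code) Q.code.2.1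
        (improvement Q.code.1 Q.code.2.2 l) = false := by
      by_contra hc
      rw [Bool.not_eq_false] at hc
      obtain ⟨l', -, hl'⟩ := List.any_eq_true.1 hc
      obtain ⟨hsat, hcomp⟩ := (isModel_iff hd _ _ l').1 hl'
      have h1 : P l' := (isModel_iff hd _ _ l').2
        ⟨fun c hcc => hsat c (List.mem_cons_of_mem _ hcc), hcomp⟩
      have h2 := hmin _ ⟨l', h1, rfl⟩
      have h3 : LinExpr.eval Q.code.2.2 (listAssignment l') <
          LinExpr.eval Q.code.2.2 (listAssignment l) := hsat _ List.mem_cons_self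
      omega
    rw [acceptModel, hl, cond_true, Bool.eq_false_iff.2 (hlow l hl), cond_false, hbelow,
      cond_false]

variable [Countable (Σ n, L.Functions n)] [Countable (Σ n, L.Relations n)]

/-- A run that the search returns is complete. -/
theorem isCompleteRun_of_mem_searchStep (hT : StablyInfinite T)
    (hd : ∀ Γ : List (Bool × Atom L), d (Γ.map fun l => (l.1, l.2.code)) = true ↔
      Satisfiable T {φ | ∃ l ∈ Γ, φ = literalFormula l})
    (lb : Subproblem → EReal) {n : ℕ} {run : List StateCode}
    (h : searchStep d Q.code n = some run) :
    IsCompleteRun T Q lb (run.map StateCode.toState) := by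
  have hQ := Q.interfaceBelow_varBound
  have hCs : ∀ c ∈ Q.constraints, LinExpr.varBound c.1 ≤ instanceVarBound Q.code :=
    fun c hc => Q.constraint_varBound_le hc
  have hM : ∀ A, IsTModel T Q Q.root A ↔
      (∀ c ∈ Q.constraints, c.Sat A) ∧ Compatible T Q (instanceVarBound Q.code) A := fun A => by
    rw [isTModel_iff hT Q hQ, Q.root_sat_iff]
  have hfeas := feasible_iff hd hQ Q.constraints hCs
  rw [searchStep] at h
  change (bif feasible d _ Q.code.2.1 Q.constraints then _ else _) = _ at h
  cases hF : feasible d (instanceVarBound Q.code) Q.code.2.1 Q.constraints with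
  | false =>
    rw [hF, cond_false, Option.some_inj] at h
    subst h
    have hno : ¬ ∃ A : Assignment, (∀ c ∈ Q.constraints, c.Sat A) ∧
        Compatible T Q (instanceVarBound Q.code) A := by
      rw [← hfeas, hF]
      simp
    refine isCompleteRun_refutationRun (fun hsat => hno ?_) fun B hB => hno ⟨B, (hM B).1 hB⟩
    have hroot : Q.root.formulas L = cFormulas L Q.root.C := by
      ext φ
      simp [Subproblem.formulas, dFormulas, Instance.root]
    rw [hroot] at hsat
    obtain ⟨A, M, i, v, hA, hMT, hag⟩ :=
      exists_sat_agrees_of_satisfiable T Q _ hQ.2 Q.root.C hsat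
    exact ⟨A, fun c hc => hA c (by simpa [Instance.root] using hc), M, i, v, hMT, hag⟩
  | true =>
    rw [hF, cond_true] at h
    obtain ⟨l, -, h⟩ := Option.bind_eq_some_iff.1 h
    rw [acceptModel] at h
    cases hl : isModel d (instanceVarBound Q.code) Q.code.2.1 Q.code.1 l with
    | false => simp [hl] at h
    | true =>
      have hl' := (isModel_iff hd _ Q.constraints l).1 hl
      rw [hl, cond_true] at h
      cases hlow : isLow (instanceVarBound Q.code) Q.code.1 Q.code.2.2 l with
      | true =>
        rw [hlow, cond_true, Option.some_inj] at h
        subst h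
        refine isCompleteRun_unbounded l ((hM _).2 hl') fun k => ?_
        obtain ⟨B, hB, hcB, hk⟩ := hl'.2.unbounded hQ Q.constraints hCs Q.objective
          Q.objective_varBound_le _ hl'.1 (of_decide_eq_true hlow) k
        exact ⟨B, (hM B).2 ⟨hB, hcB⟩, hk⟩
      | false =>
        rw [hlow, cond_false] at h
        cases hI : feasible d (instanceVarBound Q.code) Q.code.2.1
            (improvement Q.code.1 Q.code.2.2 l) with
        | true => simp [hI] at h
        | false =>
          rw [hI, cond_false, Option.some_inj] at h
          subst h
          refine isCompleteRun_retire l ((hM _).2 hl') fun B hB => ?_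
          by_contra! hlt
          obtain ⟨hB, hcB⟩ := (hM B).1 hB
          have : feasible d (instanceVarBound Q.code) Q.code.2.1
              (improvement Q.code.1 Q.code.2.2 l) = true := by
            refine (feasible_iff hd hQ _ ?_).2 ⟨B, ?_, hcB⟩
            · rintro c (_ | ⟨_, hc⟩)
              · exact Q.objective_varBound_le
              · exact hCs c hc
            · rintro c (_ | ⟨_, hc⟩)
              · exact hlt
              · exact hB c hc
          rw [hI] at this
          exact Bool.noConfusion this

end Search

end IMT

theorem theorem4 (L : FirstOrder.Language.{0, 0})
    [Primcodable (Σ n, L.Functions n)] [Primcodable (Σ n, L.Relations n)]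
    (T : L.Theory) (hdec : IMT.DecidableTheory T) (hinf : IMT.StablyInfinite T) :
    ∃ f : IMT.InstanceCode L →. List IMT.StateCode, Partrec f ∧
      ∀ (Q : IMT.Instance L) (lb : IMT.Subproblem → EReal),
        IMT.IsLowerBounding Q.objective lb →
          ∃ run ∈ f Q.code, IMT.IsCompleteRun T Q lb (run.map IMT.StateCode.toState) := by
  obtain ⟨d, hd, hdT⟩ := hdec
  have : Countable (Σ n, L.Functions n) := Encodable.countable
  have : Countable (Σ n, L.Relations n) := Encodable.countable
  refine ⟨fun q => Nat.rfindOpt (IMT.searchStep d q),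
    Partrec.rfindOpt (IMT.computable_searchStep hd), fun Q lb _ => ?_⟩
  have hdom := Nat.rfindOpt_dom.2 (IMT.exists_mem_searchStep hdT Q)
  obtain ⟨run, hrun⟩ := Part.dom_iff_mem.1 hdom
  obtain ⟨n, hn⟩ := Nat.rfindOpt_spec hrun
  exact ⟨run, hrun, IMT.isCompleteRun_of_mem_searchStep hinf hdT lb hn⟩
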